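/- **Setting.** Let $n,m\in\mathbb N$, $\Lambda=\mathrm{diag}(-I_n,I_m)$ and $U(n,m)=\{\Phi\in GL_{n+m}(\mathbb C):\Phi^*\Lambda\Phi=\Lambda\}$, with Lie algebra $\mathfrak u(n,m)$ and the left-invariant metric given at the identity by $\langle A,B\rangle=\tfrac12\mathrm{Re}\,\mathrm{Tr}(A^*B)$. Embed $U(n)\times U(m)$ block-diagonally in $U(n,m)$ and let $D_{n,m}=U(n,m)/(U(n)\times U(m))$, with projection $\tilde\pi:U(n,m)\to D_{n,m}$. Consider the principal bundle $U(n)\to U(n,m)/U(m)\xrightarrow{\ \pi\ }D_{n,m}$, where $h\in U(n)$ acts on the right by $(\gamma U(m))\cdot h=\gamma\,\mathrm{diag}(h,I_m)U(m)$; the metrics on the quotients are those making the projections Riemannian submersions. A smooth curve $t\mapsto\gamma(t)U(m)$ ($\gamma$ smooth in $U(n,m)$) is horizontal for $\pi$ if it is orthogonal to the fibres, i.e. if $\gamma^{-1}\gamma'$ is orthogonal to $\mathfrak u(n)=\{\mathrm{diag}(A,0):A^*=-A\}$ at every time. For $Y\in M_{m\times n}(\mathbb C)$ put $\widehat Y=\begin{pmatrix}0&Y^*\\Y&0\end{pmatrix}\in\mathfrak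 u(n,m)$. Let $X\in M_{m\times n}(\mathbb C)$, $X\neq0$, let $g\in U(n,m)$, and put $W=X/|\widehat X|$. The complex surface related to $(X,g)$ is $S=\{\tilde\pi(g e^{\widehat{zW}}):z\in\mathbb C\}\subset D_{n,m}$, with the complex structure (and the corresponding smooth structure and orientation) for which the bijection $\mathbb C\to S$, $z\mapsto\tilde\pi(g e^{\widehat{zW}})$, is biholomorphic. The area form $\omega_{(X,g)}$ on $S$ is defined, for $g_1=ge^{\widehat{zW}}$ and vectors $x,y$ tangent at $g_1$ to the surface $\{ge^{\widehat{zW}}:z\in\mathbb C\}\subset U(n,m)$, by $$\omega_{(X,g)}(\tilde\pi_*x,\tilde\pi_*y)=\det\begin{pmatrix}\langle g_1^{-1}x,\widehat W\rangle&\langle g_1^{-1}y,\widehat W\rangle\\ \langle g_1^{-1}x,\widehat{iW}\rangle&\langle g_1^{-1}y,\widehat{iW}\rangle\end{pmatrix}.$$ **Theorem 1.** Let $c:[0,1]\to S$ be a smooth, simple, closed, orientation-preserving (i.e. positively oriented) curve, with $c(0)=\tilde\pi(ge^{\widehat{z_0W}})$, and let $\mathrm{Area}(c)=\int\omega_{(X,g)}$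 over the region of $S$ surrounded by $c$. Then there is $$\Psi\in\mathrm{Span}_{\mathbb R}\{i(X^*X)^k\}_{k=1}^{q}\subset\mathfrak u(n),\quad q=\mathrm{rk}\,X,\qquad\text{with}\qquad \mathrm{Tr}(\Psi)=2i\,\mathrm{Area}(c),$$ such that the following holds. Through every point of the fibre over $c(0)$ there is a horizontal lift of $c$ to $U(n,m)/U(m)$. Every horizontal lift $\hat c$ that starts at $\hat c(0)=(ge^{\widehat{z_0W}}U(m))\cdot h$, with $h\in U(n)$ commuting with $X^*X$ (for example $h=1$, or $h=e^{\Psi_0}$ with $\Psi_0$ in the above span), satisfies $$\hat c(1)=\hat c(0)\cdot e^{\Psi}.$$ For an arbitrary $h\in U(n)$, a horizontal lift $\hat c$ that starts at $\hat c(0)=(ge^{\widehat{z_0W}}U(m))\cdot h$ satisfies $\hat c(1)=\hat c(0)\cdot\big(h^{-1}e^{\Psi}h\big)=\hat c(0)\cdot e^{h^{-1}\Psi h}$. -/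

import Mathlib

open Matrix

namespace HolonomyU

noncomputable section

/-- `(n+m) × (n+m)` complex matrices in block form. -/
abbrev BMat (n m : ℕ) : Type := Matrix (Fin n ⊕ Fin m) (Fin n ⊕ Fin m) ℂ

/-- The matrix `diag(-I_n, I_m)` of the Hermitian form of signature `(n, m)`. -/
def Lam (n m : ℕ) : BMat n m := fromBlocks (-1) 0 0 1

/-- The group `U(n,m) = {Φ ∈ GL_{n+m}(ℂ) | Φ* Λ Φ = Λ}`. -/
def U (n m : ℕ) : Subgroup (GL (Fin n ⊕ Fin m) ℂ) where
  carrier := {Φ | (Φ : BMat n m)ᴴ * Lam n m * (Φ : BMat n m) = Lam n m}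
  one_mem' := by simp
  mul_mem' := by
    intro a b ha hb
    simp only [Set.mem_ofPred_eq] at ha hb ⊢
    calc ((a * b : GL (Fin n ⊕ Fin m) ℂ) : BMat n m)ᴴ * Lam n m *
          ((a * b : GL (Fin n ⊕ Fin m) ℂ) : BMat n m)
        = (b : BMat n m)ᴴ * ((a : BMat n m)ᴴ * Lam n m * (a : BMat n m)) * (b : BMat n m) := by
          simp only [Units.val_mul, conjTranspose_mul, Matrix.mul_assoc]
      _ = Lam n m := by rw [ha, hb]
  inv_mem' := by
    intro a ha
    simp only [Set.mem_ofPred_eq] at ha ⊢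
    have h1 : (a : BMat n m) * ((a⁻¹ : GL (Fin n ⊕ Fin m) ℂ) : BMat n m) = 1 := by
      rw [← Units.val_mul, mul_inv_cancel, Units.val_one]
    have h2 : ((a⁻¹ : GL (Fin n ⊕ Fin m) ℂ) : BMat n m)ᴴ * (a : BMat n m)ᴴ = 1 := by
      rw [← conjTranspose_mul, h1, conjTranspose_one]
    calc ((a⁻¹ : GL (Fin n ⊕ Fin m) ℂ) : BMat n m)ᴴ * Lam n m *
          ((a⁻¹ : GL (Fin n ⊕ Fin m) ℂ) : BMat n m)
        = ((a⁻¹ : GL (Fin n ⊕ Fin m) ℂ) : BMat n m)ᴴ *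
            ((a : BMat n m)ᴴ * Lam n m * (a : BMat n m)) *
            ((a⁻¹ : GL (Fin n ⊕ Fin m) ℂ) : BMat n m) := by rw [ha]
      _ = (((a⁻¹ : GL (Fin n ⊕ Fin m) ℂ) : BMat n m)ᴴ * (a : BMat n m)ᴴ) * Lam n m *
            ((a : BMat n m) * ((a⁻¹ : GL (Fin n ⊕ Fin m) ℂ) : BMat n m)) := by
          simp only [Matrix.mul_assoc]
      _ = Lam n m := by rw [h1, h2, Matrix.one_mul, Matrix.mul_one]

/-- The underlying matrix of an element of `U(n,m)`. -/
def mat {n m : ℕ} (g : U n m) : BMat n m := ((g : GL (Fin n ⊕ Fin m) ℂ) : BMat n m)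

/-- The embedding `U(n) × U(m) → U(n,m)`, `(A, B) ↦ diag(A, B)`. -/
def blockDiag (n m : ℕ) :
    unitaryGroup (Fin n) ℂ × unitaryGroup (Fin m) ℂ →* U n m where
  toFun p :=
    ⟨⟨fromBlocks (p.1 : Matrix (Fin n) (Fin n) ℂ) 0 0 (p.2 : Matrix (Fin m) (Fin m) ℂ),
      fromBlocks (star (p.1 : Matrix (Fin n) (Fin n) ℂ)) 0 0
        (star (p.2 : Matrix (Fin m) (Fin m) ℂ)),
      by simp [fromBlocks_multiply], by simp [fromBlocks_multiply]⟩,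
      by
        have h1 : (p.1 : Matrix (Fin n) (Fin n) ℂ)ᴴ * (p.1 : Matrix (Fin n) (Fin n) ℂ) = 1 :=
          Unitary.coe_star_mul_self p.1
        have h2 : (p.2 : Matrix (Fin m) (Fin m) ℂ)ᴴ * (p.2 : Matrix (Fin m) (Fin m) ℂ) = 1 :=
          Unitary.coe_star_mul_self p.2
        simp [U, Lam, fromBlocks_conjTranspose, fromBlocks_multiply, h1, h2]⟩
  map_one' := by
    apply Subtype.ext
    apply Units.ext
    simp
  map_mul' p q := by
    apply Subtype.ext
    apply Units.ext
    simp [fromBlocks_multiply]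

/-- The subgroup `U(n) × U(m)` of `U(n,m)`. -/
def subUU (n m : ℕ) : Subgroup (U n m) := (blockDiag n m).range

/-- The subgroup `U(m)` of `U(n,m)`. -/
def subU (n m : ℕ) : Subgroup (U n m) :=
  ((blockDiag n m).comp (MonoidHom.inr (unitaryGroup (Fin n) ℂ) (unitaryGroup (Fin m) ℂ))).range

theorem subU_le (n m : ℕ) : subU n m ≤ subUU n m := by
  rintro _ ⟨B, rfl⟩
  exact ⟨(1, B), rfl⟩

/-- The base space `D_{n,m} = U(n,m) / (U(n) × U(m))`. -/
abbrev D (n m : ℕ) : Type := U n m ⧸ subUU n m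

/-- The total space `U(n,m) / U(m)`. -/
abbrev E (n m : ℕ) : Type := U n m ⧸ subU n m

/-- The projection `U(n,m) → D_{n,m}`. -/
def projD {n m : ℕ} (g : U n m) : D n m := (g : U n m ⧸ subUU n m)

/-- The projection `U(n,m) → U(n,m)/U(m)`. -/
def projE {n m : ℕ} (g : U n m) : E n m := (g : U n m ⧸ subU n m)

/-- The bundle projection `π : U(n,m)/U(m) → D_{n,m}`. -/
def bundleProj {n m : ℕ} : E n m → D n m := Subgroup.quotientMapOfLE (subU_le n m)

/-- The right action of `U(n)` on `U(n,m)/U(m)`: `(g U(m)) · h = (g diag(h, I_m)) U(m)`. -/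
def act {n m : ℕ} (p : E n m) (h : unitaryGroup (Fin n) ℂ) : E n m :=
  Quotient.map' (fun γ : U n m => γ * blockDiag n m (h, 1))
    (by
      intro a b hab
      rw [QuotientGroup.leftRel_apply] at hab ⊢
      obtain ⟨B, hB⟩ := hab
      refine ⟨B, ?_⟩
      have hB' : blockDiag n m (1, B) = a⁻¹ * b := hB
      change blockDiag n m (1, B) = _
      calc blockDiag n m (1, B)
          = (blockDiag n m (h, 1))⁻¹ * blockDiag n m (1, B) * blockDiag n m (h, 1) := by
            rw [← map_inv, ← map_mul, ← map_mul]
            simp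
        _ = _ := by rw [hB']; group) p

/-- The inner product `⟨A, B⟩ = (1/2) Re Tr(A* B)` on `𝔲(n,m) = T_e U(n,m)`. It defines the
left invariant metric of `U(n,m)`. -/
def metric {n m : ℕ} (A B : BMat n m) : ℝ := (1 / 2) * (trace (Aᴴ * B)).re

/-- `X̂ = [[0, X*], [X, 0]] ∈ 𝔲(n,m)`. -/
def hat {n m : ℕ} (X : Matrix (Fin m) (Fin n) ℂ) : BMat n m := fromBlocks 0 Xᴴ X 0

/-- `W = X / |X̂|`. -/
def unitW {n m : ℕ} (X : Matrix (Fin m) (Fin n) ℂ) : Matrix (Fin m) (Fin n) ℂ :=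
  (((Real.sqrt (metric (hat X) (hat X)))⁻¹ : ℝ) : ℂ) • X

theorem lam_mul_lam (n m : ℕ) : Lam n m * Lam n m = 1 := by
  simp [Lam, fromBlocks_multiply]

/-- `e^{Ŷ}` as an element of `U(n,m)`. -/
def expHat {n m : ℕ} (Y : Matrix (Fin m) (Fin n) ℂ) : U n m :=
  ⟨⟨NormedSpace.exp (hat Y), NormedSpace.exp (-hat Y),
    by
      rw [← Matrix.exp_add_of_commute _ _ ((Commute.refl (hat Y)).neg_right), add_neg_cancel,
        NormedSpace.exp_zero],
    by
      rw [← Matrix.exp_add_of_commute _ _ ((Commute.refl (hat Y)).neg_left), neg_add_cancel,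
        NormedSpace.exp_zero]⟩,
    by
      have hL : (Lam n m)⁻¹ = Lam n m := Matrix.inv_eq_left_inv (lam_mul_lam n m)
      have hu : IsUnit (Lam n m) :=
        ⟨⟨Lam n m, Lam n m, lam_mul_lam n m, lam_mul_lam n m⟩, rfl⟩
      have hc : Lam n m * hat Y * (Lam n m)⁻¹ = -hat Y := by
        rw [hL]
        simp [Lam, hat, fromBlocks_multiply, fromBlocks_neg]
      have hH : (hat Y)ᴴ = hat Y := by simp [hat, fromBlocks_conjTranspose]
      have he := Matrix.exp_conj (Lam n m) (hat Y) hu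
      rw [hc, hL] at he
      change (NormedSpace.exp (hat Y))ᴴ * Lam n m * NormedSpace.exp (hat Y) = Lam n m
      rw [← Matrix.exp_conjTranspose, hH]
      have h3 : Lam n m * NormedSpace.exp (hat Y)
          = NormedSpace.exp (-hat Y) * Lam n m := by
        rw [he, Matrix.mul_assoc _ (Lam n m) (Lam n m), lam_mul_lam, Matrix.mul_one]
      rw [Matrix.mul_assoc, h3, ← Matrix.mul_assoc,
        ← Matrix.exp_add_of_commute _ _ ((Commute.refl (hat Y)).neg_right), add_neg_cancel,
        NormedSpace.exp_zero, Matrix.one_mul]⟩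

/-- The parametrization `z ↦ g e^{(zW)^}` of the surface `g S̃` in `U(n,m)`. -/
def surfUp {n m : ℕ} (X : Matrix (Fin m) (Fin n) ℂ) (g : U n m) (z : ℂ) : U n m :=
  g * expHat (z • unitW X)

/-- The parametrization `z ↦ g e^{(zW)^} (U(n) × U(m))` of the complex surface `S` related to
`(X, g)` in `D_{n,m}`. For `X ≠ 0` it is injective; it carries the complex structure of `S`. -/
def surf {n m : ℕ} (X : Matrix (Fin m) (Fin n) ℂ) (g : U n m) (z : ℂ) : D n m :=
  projD (surfUp X g z)

/-- The complex surface `S` related to `(X, g)` in `D_{n,m}`. -/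
def surface {n m : ℕ} (X : Matrix (Fin m) (Fin n) ℂ) (g : U n m) : Set (D n m) :=
  Set.range (surf X g)

/-- The global complex coordinate on `S`, the inverse of `surf X g` on `S`. -/
def coord {n m : ℕ} (X : Matrix (Fin m) (Fin n) ℂ) (g : U n m) : D n m → ℂ :=
  Function.invFun (surf X g)

/-- `c` (restricted to `[0,1]`) is a smooth simple closed curve on the surface `S`. -/
structure IsSmoothSimpleClosedOn {n m : ℕ} (X : Matrix (Fin m) (Fin n) ℂ) (g : U n m)
    (c : ℝ → D n m) : Prop where
  mem : ∀ t ∈ Set.Icc (0 : ℝ) 1, c t ∈ surface X g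
  smooth : ContDiffOn ℝ (⊤ : ℕ∞) (fun t => coord X g (c t)) (Set.Icc 0 1)
  closed : c 0 = c 1
  simple : Set.InjOn c (Set.Ico 0 1)

/-- The region of `S` surrounded by `c`, in the coordinate of `S`: the points off the curve whose
connected component in the complement of the curve is bounded. -/
def region {n m : ℕ} (X : Matrix (Fin m) (Fin n) ℂ) (g : U n m) (c : ℝ → D n m) : Set ℂ :=
  {p | p ∉ (fun t => coord X g (c t)) '' Set.Icc 0 1 ∧
    Bornology.IsBounded
      (connectedComponentIn ((fun t => coord X g (c t)) '' Set.Icc 0 1)ᶜ p)}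

/-- The closed curve `c` on `S` is orientation-preserving (positively oriented) for the
orientation of `S` given by its complex structure: its winding number about each point of the
region that it surrounds is `+1`. -/
def IsOrientationPreserving {n m : ℕ} (X : Matrix (Fin m) (Fin n) ℂ) (g : U n m)
    (c : ℝ → D n m) : Prop :=
  ∀ p ∈ region X g c,
    (2 * Real.pi * Complex.I)⁻¹ * ∫ t in (0 : ℝ)..1,
      derivWithin (fun s => coord X g (c s)) (Set.Icc 0 1) t / (coord X g (c t) - p) = 1

/-- The area form `ω_{(X,g)}` at the point of `S` below `g₁ ∈ g S̃`, evaluated on the images of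
the tangent vectors `x`, `y` of `g S̃` at `g₁`. -/
def areaForm {n m : ℕ} (X : Matrix (Fin m) (Fin n) ℂ) (g₁ : U n m) (x y : BMat n m) : ℝ :=
  Matrix.det
    !![metric (mat g₁⁻¹ * x) (hat (unitW X)), metric (mat g₁⁻¹ * y) (hat (unitW X));
       metric (mat g₁⁻¹ * x) (hat (Complex.I • unitW X)),
       metric (mat g₁⁻¹ * y) (hat (Complex.I • unitW X))]

/-- The tangent vector of `g S̃` at `g e^{(zW)^}`: the derivative of the parametrization at `z` in
the direction `v`. -/
def tangentUp {n m : ℕ} (X : Matrix (Fin m) (Fin n) ℂ) (g : U n m) (z v : ℂ) : BMat n m :=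
  Matrix.of fun i j => deriv (fun s : ℝ => mat (surfUp X g (z + (s : ℂ) * v)) i j) 0

/-- `Area(c)`: the integral over the region surrounded by `c` of the area form `ω_{(X,g)}`,
written in the coordinate `z = x + i y` of `S` as `∫ ω(∂/∂x, ∂/∂y) dx dy`. -/
def Area {n m : ℕ} (X : Matrix (Fin m) (Fin n) ℂ) (g : U n m) (c : ℝ → D n m) : ℝ :=
  ∫ z in region X g c,
    areaForm X (surfUp X g z) (tangentUp X g z 1) (tangentUp X g z Complex.I)

/-- The velocity at time `t` of a curve `γ : [0,1] → U(n,m)`, as a matrix. -/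
def velocity {n m : ℕ} (γ : ℝ → U n m) (t : ℝ) : BMat n m :=
  Matrix.of fun i j => derivWithin (fun s => mat (γ s) i j) (Set.Icc 0 1) t

/-- `γ` (restricted to `[0,1]`) is a smooth curve in `U(n,m)`. -/
def IsSmoothUp {n m : ℕ} (γ : ℝ → U n m) : Prop :=
  ∀ i j, ContDiffOn ℝ (⊤ : ℕ∞) (fun t => mat (γ t) i j) (Set.Icc 0 1)

/-- `ĉ : [0,1] → U(n,m)/U(m)` is a horizontal lift of `c : [0,1] → D_{n,m}` for the Riemannian
submersion `π`. A smooth curve in `U(n,m)/U(m)` is the image of a smooth curve `γ` in `U(n,m)`.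
The tangent space of `U(n,m)/U(m)` at `γ U(m)` is, by left translation, the orthogonal
complement of `𝔲(m)` in `𝔲(n,m)`, with the vertical space of `π` equal to `𝔲(n)`; as `𝔲(n)` is
orthogonal to `𝔲(m)`, the velocity is horizontal when `γ⁻¹ γ'` is orthogonal to `𝔲(n)`. -/
def IsHorizontalLift {n m : ℕ} (c : ℝ → D n m) (chat : ℝ → E n m) : Prop :=
  (∀ t ∈ Set.Icc (0 : ℝ) 1, bundleProj (chat t) = c t) ∧
  ∃ γ : ℝ → U n m, IsSmoothUp γ ∧
    (∀ t ∈ Set.Icc (0 : ℝ) 1, projE (γ t) = chat t) ∧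
    ∀ t ∈ Set.Icc (0 : ℝ) 1, ∀ A : Matrix (Fin n) (Fin n) ℂ, Aᴴ = -A →
      metric (mat (γ t)⁻¹ * velocity γ t) (fromBlocks A 0 0 0) = 0

/-- The point `g e^{(zW)^} U(m)` of the fibre over `p ∈ S`, where `z` is the coordinate of `p`. -/
def basePoint {n m : ℕ} (X : Matrix (Fin m) (Fin n) ℂ) (g : U n m) (p : D n m) : E n m :=
  projE (surfUp X g (coord X g p))

/-- `Span_ℝ {i (X* X)^k | k = 1, …, rk X}`. -/
def holSpan {n m : ℕ} (X : Matrix (Fin m) (Fin n) ℂ) :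
    Submodule ℝ (Matrix (Fin n) (Fin n) ℂ) :=
  Submodule.span ℝ ((fun k : ℕ => Complex.I • (Xᴴ * X) ^ k) '' Set.Icc 1 X.rank)

end

end HolonomyU

open HolonomyU

/-! Write W = X/|X̂| and let σ_j be the singular values of W, indexed by an eigenbasis V of X*X.
Over S the fibre is trivialised by the frame g·exp((zW)^): a lift of c is γ = g·exp((zW)^)·diag(k,
l), and horizontality says that k' = -ω₁₁ k, where ω₁₁ is the 𝔲(n)-block of the pullback ω of the
Maurer–Cartan form under z ↦ exp((zW)^).

To find ω, split a velocity v into Re(v/z)·z + Im(v/z)·iz. The radial direction is a one-parameter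
group and contributes nothing to ω₁₁. The rotational direction is conjugation by diag(1, e^{is}),
because (cY)^ = diag(1,c) Ŷ diag(1,c̄). With E = exp((zW)^) and E⁻¹ = ΛEΛ it gives (i/2)Λ(E² - 1).
The upper left block of E² is V diag(cosh 2σ_j|z|) V*, so ω₁₁ = V diag(-i sinh²(σ_j|z|) Im(v/z)) V*
(`pullbackMC_unitW_toBlocks₁₁`). The values of ω₁₁ all commute, so k is obtained by integrating n
scalar phases: k(1) = V diag(e^{iτ_j}) V* k(0) with τ_j = ∫ sinh²(σ_j|z|) Im(dz/z)
(`eq_phaseUnitary_mul`). Put Ψ = V diag(iτ_j) V*.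

The trace of Ψ comes from Green's formula (`integral_radial_div_eq_integral_boundedRegion`): τ_j is
the integral of σ_j sinh(2σ_j|p|)/|p| over the surrounded region, and half the sum over j of these
densities is the density of the area form (`areaForm_tangentUp`). Green's formula is proved without
any Jordan curve theorem, by applying Fubini to z'(t) φ(|p|)/(z(t) - p): the p-integral is the
Cauchy transform of a radial density, the t-integral is a winding number.

Finally τ_j is a function, vanishing at 0, of the j-th eigenvalue of X*X, so interpolation puts Ψ
into the span of i(X*X)^k with 1 ≤ k ≤ rk X (`gramConj_mem_holSpan`). -/

section

open MeasureTheory Set Metric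

/-! ### Cauchy transforms of radial densities on a disc. -/

/-- The function `p ↦ 1 / ‖p‖` is integrable on discs of the plane. -/
theorem integrableOn_inv_norm_ball (R : ℝ) :
    IntegrableOn (fun p : ℂ => ‖p‖⁻¹) (ball 0 R) := by
  have := integrableOn_ball_of_norm_le_rpow (E := ℂ) (F := ℝ) (μ := volume)
    (f := fun p : ℂ => ‖p‖⁻¹) (C := 1) (α := 1) (r := R) (by simp) (by simp) ?_ ?_
  · exact this
  · filter_upwards with p
    simp [Real.rpow_neg_one]
  · exact (measurable_norm.inv).aestronglyMeasurable

/-- Mean value property: the pole ζ lies outside the disc of radius s. -/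
theorem circleAverage_inv_sub_of_lt {ζ : ℂ} {s : ℝ} (hs : 0 ≤ s) (h : s < ‖ζ‖) :
    Real.circleAverage (fun p => (ζ - p)⁻¹) 0 s = ζ⁻¹ := by
  have hd : DiffContOnCl ℂ (fun p : ℂ => (ζ - p)⁻¹) (ball 0 |s|) := by
    apply DifferentiableOn.diffContOnCl
    intro p hp
    have hp' : ‖p‖ ≤ s := by
      have := closure_ball_subset_closedBall hp
      simpa [abs_of_nonneg hs] using this
    have : ζ - p ≠ 0 := by
      intro h0
      rw [sub_eq_zero] at h0
      subst h0
      linarith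
    fun_prop (disch := exact this)
  simpa using hd.circleAverage

/-- On the circle conj p = s²/p, so the conjugate of 1/(ζ - p) agrees there with p/(p·conj ζ - s²).
This is holomorphic on the disc, as |p·conj ζ| < s², and vanishes at the centre. -/
theorem circleAverage_inv_sub_of_gt {ζ : ℂ} {s : ℝ} (h : ‖ζ‖ < s) :
    Real.circleAverage (fun p => (ζ - p)⁻¹) 0 s = 0 := by
  have hs : 0 < s := (norm_nonneg _).trans_lt h
  let g : ℂ → ℂ := fun p => p / (p * starRingEnd ℂ ζ - s ^ 2)
  have hd : DiffContOnCl ℂ g (ball 0 |s|) := by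
    apply DifferentiableOn.diffContOnCl
    intro p hp
    have hp' : ‖p‖ ≤ s := by
      have := closure_ball_subset_closedBall hp
      simpa [abs_of_pos hs] using this
    have : p * starRingEnd ℂ ζ - s ^ 2 ≠ 0 := by
      intro h0
      rw [sub_eq_zero] at h0
      have h1 := congrArg norm h0
      simp only [norm_mul, RCLike.norm_conj, norm_pow, Complex.norm_real, Real.norm_eq_abs,
        abs_of_pos hs] at h1
      nlinarith [norm_nonneg p, norm_nonneg ζ]
    have : DifferentiableAt ℂ g p := by
      fun_prop (disch := exact this)
    exact this.differentiableWithinAt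
  have h0 : Real.circleAverage g 0 s = 0 := by simpa [g] using hd.circleAverage
  have hi : CircleIntegrable g 0 s := by
    apply ContinuousOn.circleIntegrable'
    refine hd.2.mono ?_
    rw [closure_ball _ (by simpa using hs.ne')]
    exact sphere_subset_closedBall
  have h1 := ContinuousLinearMap.circleAverage_comp_comm (Complex.conjCLE : ℂ →L[ℝ] ℂ) hi
  rw [h0, map_zero] at h1
  refine Eq.trans (Real.circleAverage_congr_sphere ?_) h1
  intro p hp
  rw [mem_sphere_iff_norm, sub_zero, abs_of_pos hs] at hp
  have hpp : p * starRingEnd ℂ p = s ^ 2 := by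
    rw [Complex.mul_conj', hp]
  have hp0 : p ≠ 0 := by
    intro h0
    rw [h0, norm_zero] at hp
    exact hs.ne hp
  have hcp0 : starRingEnd ℂ p ≠ 0 := by simpa using hp0
  simp only [g, Function.comp_apply, ContinuousLinearEquiv.coe_coe, Complex.conjCLE_apply]
  rw [map_div₀, map_sub, map_mul, Complex.conj_conj, map_pow, Complex.conj_ofReal, ← hpp,
    mul_comm p, ← mul_sub]
  rw [div_mul_eq_div_div, div_self hcp0, one_div]

theorem setIntegral_angle_eq_circleAverage (g : ℂ → ℂ) (s : ℝ) :
    ∫ α in Ioo (-Real.pi) Real.pi, g (s * (Real.cos α + Real.sin α * Complex.I))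
      = (2 * Real.pi : ℝ) • Real.circleAverage g 0 s := by
  rw [Real.circleAverage_eq_integral_add (-Real.pi),
    smul_smul, mul_inv_cancel₀ (by positivity), one_smul]
  rw [← integral_Ioc_eq_integral_Ioo, ← intervalIntegral.integral_of_le (by linarith [Real.pi_pos])]
  rw [intervalIntegral.integral_comp_add_right (fun θ => g (circleMap 0 s θ))]
  have : 2 * Real.pi + -Real.pi = Real.pi := by ring
  rw [this, zero_add]
  simp [circleMap, Complex.exp_mul_I]

/-- The translate of the disc by ζ lies in the disc of radius 2R. The resulting bound is uniform in
ζ, as the Fubini argument for a moving pole requires. -/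
theorem integrableOn_inv_norm_sub_ball {ζ : ℂ} {R : ℝ} (hζ : ‖ζ‖ < R) :
    IntegrableOn (fun p : ℂ => ‖ζ - p‖⁻¹) (ball 0 R) ∧
    ∫ p in ball 0 R, ‖ζ - p‖⁻¹ ≤ ∫ p in ball (0 : ℂ) (2 * R), ‖p‖⁻¹ := by
  have h0 : Integrable ((ball (0 : ℂ) (2 * R)).indicator fun p : ℂ => ‖p‖⁻¹) :=
    (integrable_indicator_iff measurableSet_ball).2 (integrableOn_inv_norm_ball _)
  have h1 := h0.comp_sub_left ζ
  have hle : ∀ p, (ball (0 : ℂ) R).indicator (fun p : ℂ => ‖ζ - p‖⁻¹) p ≤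
      (ball (0 : ℂ) (2 * R)).indicator (fun p : ℂ => ‖p‖⁻¹) (ζ - p) := by
    intro p
    apply indicator_le'
    · intro p hp
      rw [indicator_of_mem]
      rw [mem_ball_zero_iff] at hp ⊢
      linarith [norm_sub_le ζ p]
    · intro p _
      exact indicator_nonneg (fun _ _ => by positivity) _
  have hi : Integrable ((ball (0 : ℂ) R).indicator (fun p : ℂ => ‖ζ - p‖⁻¹)) := by
    refine h1.mono' ?_ (Filter.Eventually.of_forall fun p => ?_)
    · exact ((measurable_const.sub measurable_id).norm.inv.indicator
        measurableSet_ball).aestronglyMeasurable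
    · rw [Real.norm_of_nonneg (indicator_nonneg (fun _ _ => by positivity) _)]
      exact hle p
  refine ⟨(integrable_indicator_iff measurableSet_ball).1 hi, ?_⟩
  rw [← integral_indicator measurableSet_ball, ← integral_indicator measurableSet_ball]
  calc _ ≤ ∫ p, (ball (0 : ℂ) (2 * R)).indicator (fun p : ℂ => ‖p‖⁻¹) (ζ - p) :=
        integral_mono hi h1 hle
    _ = _ := integral_sub_left_eq_self _ _ ζ

theorem integral_eq_polar_iterated {F : ℂ → ℂ} (hm : Measurable F) (hF : Integrable F) :
    ∫ p, F p = ∫ s in Ioi (0 : ℝ), ∫ α in Ioo (-Real.pi) Real.pi,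
      s • F (s * (Real.cos α + Real.sin α * Complex.I)) := by
  rw [← Complex.integral_comp_polarCoord_symm, polarCoord_target, Measure.volume_eq_prod,
    setIntegral_prod]
  · simp only [Complex.polarCoord_symm_apply]
  · have hmeas : Measurable fun p : ℝ × ℝ => p.1 • F (Complex.polarCoord.symm p) := by
      refine measurable_fst.smul (hm.comp ?_)
      rw [funext Complex.polarCoord_symm_apply]
      fun_prop
    refine ⟨hmeas.aestronglyMeasurable, ?_⟩
    have h2 := hF.2
    rw [HasFiniteIntegral, ← Complex.lintegral_comp_polarCoord_symm] at h2
    rw [HasFiniteIntegral]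
    refine lt_of_eq_of_lt ?_ h2
    rw [polarCoord_target, ← Measure.volume_eq_prod]
    refine setLIntegral_congr_fun (measurableSet_Ioi.prod measurableSet_Ioo) fun p hp => ?_
    simp only [enorm_smul, smul_eq_mul]
    rw [Real.enorm_of_nonneg (le_of_lt hp.1)]

/-- The Cauchy transform of a radial density on a disc. -/
theorem integral_radial_mul_inv_sub {φ : ℝ → ℝ} (hφ : Continuous φ) {ζ : ℂ} {R : ℝ}
    (hζ : ‖ζ‖ < R) :
    IntegrableOn (fun p : ℂ => (φ ‖p‖ : ℂ) * (ζ - p)⁻¹) (ball 0 R) ∧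
    ∫ p in ball (0 : ℂ) R, (φ ‖p‖ : ℂ) * (ζ - p)⁻¹ =
      (2 * Real.pi * ∫ s in (0 : ℝ)..‖ζ‖, s * φ s : ℝ) * ζ⁻¹ := by
  have hR : 0 < R := (norm_nonneg _).trans_lt hζ
  obtain ⟨M, hM⟩ := (isCompact_closedBall (0 : ℂ) R).exists_bound_of_continuousOn
    (f := fun p : ℂ => (φ ‖p‖ : ℂ)) (by fun_prop)
  have hm : Measurable fun p : ℂ => (φ ‖p‖ : ℂ) * (ζ - p)⁻¹ := by
    refine Measurable.mul ?_ (measurable_const.sub measurable_id).inv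
    exact (Continuous.measurable (by fun_prop))
  have hint : IntegrableOn (fun p : ℂ => (φ ‖p‖ : ℂ) * (ζ - p)⁻¹) (ball 0 R) := by
    refine ((integrableOn_inv_norm_sub_ball hζ).1.const_mul M).mono' hm.aestronglyMeasurable ?_
    refine (ae_restrict_iff' measurableSet_ball).2 (Filter.Eventually.of_forall fun p hp => ?_)
    rw [norm_mul, norm_inv]
    exact mul_le_mul_of_nonneg_right (hM p (ball_subset_closedBall hp)) (by positivity)
  refine ⟨hint, ?_⟩
  rw [← integral_indicator measurableSet_ball, integral_eq_polar_iterated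
    (hm.indicator measurableSet_ball) ((integrable_indicator_iff measurableSet_ball).2 hint)]
  -- Circles that do not enclose ζ contribute 2πsφ(s)/ζ, circles around it contribute nothing. The
  -- one circle through ζ is a null set of radii.
  have hinner : ∀ᵐ s : ℝ, s ∈ Ioi (0 : ℝ) →
      (∫ α in Ioo (-Real.pi) Real.pi, s • (ball (0 : ℂ) R).indicator
        (fun p : ℂ => (φ ‖p‖ : ℂ) * (ζ - p)⁻¹) (s * (Real.cos α + Real.sin α * Complex.I)))
      = (Ioc 0 ‖ζ‖).indicator (fun s => ((2 * Real.pi * (s * φ s) : ℝ) : ℂ) * ζ⁻¹) s := by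
    have : ∀ᵐ s : ℝ, s ≠ ‖ζ‖ := by simp [ae_iff, measure_singleton]
    filter_upwards [this] with s hsζ hs
    have hs : 0 < s := hs
    have hn : ∀ α : ℝ, ‖(s : ℂ) * (Real.cos α + Real.sin α * Complex.I)‖ = s := by
      intro α
      have := Complex.norm_polarCoord_symm (s, α)
      rw [Complex.polarCoord_symm_apply] at this
      rw [this]
      exact abs_of_pos hs
    by_cases hsR : s < R
    · have h1 : ∀ α : ℝ, s • (ball (0 : ℂ) R).indicator
          (fun p : ℂ => (φ ‖p‖ : ℂ) * (ζ - p)⁻¹) (s * (Real.cos α + Real.sin α * Complex.I))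
          = (s * φ s : ℝ) * (ζ - s * (Real.cos α + Real.sin α * Complex.I))⁻¹ := by
        intro α
        rw [indicator_of_mem (by rw [mem_ball_zero_iff, hn]; exact hsR), hn, Complex.real_smul]
        push_cast
        ring
      simp_rw [h1]
      rw [integral_const_mul, setIntegral_angle_eq_circleAverage (fun p => (ζ - p)⁻¹)]
      rcases lt_or_gt_of_ne hsζ with h | h
      · rw [circleAverage_inv_sub_of_lt hs.le h, indicator_of_mem (show s ∈ Ioc 0 ‖ζ‖ from ⟨hs, h.le⟩),
          Complex.real_smul]
        push_cast
        ring
      · rw [circleAverage_inv_sub_of_gt h, indicator_of_notMem (fun hh => absurd hh.2 (not_le.2 h))]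
        simp
    · have h1 : ∀ α : ℝ, s • (ball (0 : ℂ) R).indicator
          (fun p : ℂ => (φ ‖p‖ : ℂ) * (ζ - p)⁻¹) (s * (Real.cos α + Real.sin α * Complex.I))
          = 0 := by
        intro α
        rw [indicator_of_notMem (by rw [mem_ball_zero_iff, hn]; exact hsR), smul_zero]
      simp_rw [h1]
      rw [indicator_of_notMem (fun hh => hsR (hh.2.trans_lt hζ))]
      simp
  rw [setIntegral_congr_ae measurableSet_Ioi hinner]
  rw [setIntegral_indicator measurableSet_Ioc]
  have : Ioi 0 ∩ Ioc 0 ‖ζ‖ = Ioc 0 ‖ζ‖ := inter_eq_right.2 fun x hx => hx.1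
  rw [this, integral_mul_const, integral_complex_ofReal, integral_const_mul,
    intervalIntegral.integral_of_le (norm_nonneg _)]

/-! ### Bounded complementary components. -/

/-- The points off `K` that lie in a bounded component of the complement of `K`. -/
def boundedRegion (K : Set ℂ) : Set ℂ :=
  {p | p ∉ K ∧ Bornology.IsBounded (connectedComponentIn Kᶜ p)}

theorem isOpen_boundedRegion {K : Set ℂ} (hK : IsClosed K) : IsOpen (boundedRegion K) := by
  rw [isOpen_iff_mem_nhds]
  rintro p ⟨hp, hb⟩
  have ho : IsOpen (connectedComponentIn Kᶜ p) := hK.isOpen_compl.connectedComponentIn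
  refine Filter.mem_of_superset (ho.mem_nhds (mem_connectedComponentIn hp)) fun q hq => ?_
  exact ⟨connectedComponentIn_subset _ _ hq, by rwa [← connectedComponentIn_eq hq]⟩

/-- From a point outside the ball the outward ray never meets K, so its component is unbounded. -/
theorem boundedRegion_subset_ball {K : Set ℂ} {R : ℝ} (hR : 0 < R) (hK : K ⊆ ball 0 R) :
    boundedRegion K ⊆ ball 0 R := by
  rintro p ⟨hp, hb⟩
  by_contra hpR
  rw [mem_ball_zero_iff, not_lt] at hpR
  have hp0 : 0 < ‖p‖ := hR.trans_le hpR
  have hray : (fun s : ℝ => (s : ℂ) * p) '' Ici 1 ⊆ connectedComponentIn Kᶜ p := by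
    apply IsPreconnected.subset_connectedComponentIn
    · exact isPreconnected_Ici.image _ (by fun_prop)
    · exact ⟨1, by simp, by simp⟩
    · rintro _ ⟨s, hs, rfl⟩ hmem
      have := hK hmem
      rw [mem_ball_zero_iff, norm_mul, Complex.norm_real, Real.norm_eq_abs] at this
      have hs1 : 1 ≤ |s| := le_trans hs (le_abs_self s)
      nlinarith
  obtain ⟨C, hC⟩ := (hb.subset hray).exists_norm_le
  have h1 := hC _ ⟨max 1 ((C + 1) / ‖p‖), mem_Ici.2 (le_max_left _ _), rfl⟩
  rw [norm_mul, Complex.norm_real, Real.norm_eq_abs] at h1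
  have h2 : (C + 1) / ‖p‖ * ‖p‖ = C + 1 := div_mul_cancel₀ _ hp0.ne'
  have h3 := le_trans (le_max_right 1 ((C + 1) / ‖p‖)) (le_abs_self _)
  nlinarith [mul_le_mul_of_nonneg_right h3 hp0.le]

/-! ### Winding numbers and Green's formula for radial densities. -/

section Winding

variable {z z' : ℝ → ℂ}

/-- The integrand has the primitive -1/(z - p), which takes equal values at both ends of a closed
curve. -/
theorem integral_inv_sub_sq_eq_zero
    (hz : ∀ t ∈ Icc (0 : ℝ) 1, HasDerivWithinAt z (z' t) (Icc 0 1) t)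
    (hz' : ContinuousOn z' (Icc 0 1)) (hcl : z 0 = z 1) {p : ℂ} (hp : p ∉ z '' Icc 0 1) :
    ∫ t in (0 : ℝ)..1, z' t / (z t - p) ^ 2 = 0 := by
  have hzc : ContinuousOn z (Icc 0 1) := fun t ht => (hz t ht).continuousWithinAt
  have hne : ∀ t ∈ Icc (0 : ℝ) 1, z t - p ≠ 0 := fun t ht h =>
    hp ⟨t, ht, sub_eq_zero.1 h⟩
  rw [intervalIntegral.integral_eq_sub_of_hasDerivAt_of_le zero_le_one
    (f := fun t => -(z t - p)⁻¹)]
  · simp [hcl]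
  · exact ((hzc.sub continuousOn_const).inv₀ hne).neg
  · intro t ht
    have h1 := (hz t (Ioo_subset_Icc_self ht)).hasDerivAt (Icc_mem_nhds ht.1 ht.2)
    have h2 := ((h1.sub_const p).inv (hne t (Ioo_subset_Icc_self ht))).neg
    exact h2.congr_deriv (by ring)
  · apply ContinuousOn.intervalIntegrable
    rw [uIcc_of_le zero_le_one]
    exact hz'.div ((hzc.sub continuousOn_const).pow 2) fun t ht => pow_ne_zero _ (hne t ht)

/-- Differentiation under the integral sign. It makes the winding number locally constant without
knowing that it is an integer. -/
theorem hasDerivAt_integral_inv_sub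
    (hz : ∀ t ∈ Icc (0 : ℝ) 1, HasDerivWithinAt z (z' t) (Icc 0 1) t)
    (hz' : ContinuousOn z' (Icc 0 1)) (hcl : z 0 = z 1) {p : ℂ} (hp : p ∉ z '' Icc 0 1) :
    HasDerivAt (fun p => ∫ t in (0 : ℝ)..1, z' t / (z t - p)) 0 p := by
  have hzc : ContinuousOn z (Icc 0 1) := fun t ht => (hz t ht).continuousWithinAt
  have hK : IsCompact (z '' Icc 0 1) := isCompact_Icc.image_of_continuousOn hzc
  obtain ⟨M, hM⟩ := isCompact_Icc.exists_bound_of_continuousOn hz'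
  obtain ⟨d, hd, hball⟩ := Metric.isOpen_iff.1 hK.isClosed.isOpen_compl p hp
  have hdist : ∀ x ∈ ball p (d / 2), ∀ t ∈ Icc (0 : ℝ) 1, d / 2 ≤ ‖z t - x‖ := by
    intro x hx t ht
    by_contra hlt
    push Not at hlt
    have : z t ∈ ball p d := by
      rw [mem_ball, dist_eq_norm] at hx ⊢
      calc ‖z t - p‖ = ‖(z t - x) + (x - p)‖ := by ring_nf
        _ ≤ ‖z t - x‖ + ‖x - p‖ := norm_add_le _ _
        _ < d := by linarith
    exact hball this ⟨t, ht, rfl⟩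
  have hne : ∀ x ∈ ball p (d / 2), ∀ t ∈ Icc (0 : ℝ) 1, z t - x ≠ 0 := by
    intro x hx t ht h0
    have := hdist x hx t ht
    rw [h0, norm_zero] at this
    linarith
  have hsub : uIoc (0 : ℝ) 1 ⊆ Icc 0 1 := by
    rw [uIoc_of_le zero_le_one]
    exact Ioc_subset_Icc_self
  have hcont : ∀ x ∈ ball p (d / 2), ContinuousOn (fun t => z' t / (z t - x)) (Icc 0 1) :=
    fun x hx => hz'.div (hzc.sub continuousOn_const) (hne x hx)
  have hcont2 : ∀ x ∈ ball p (d / 2), ContinuousOn (fun t => z' t / (z t - x) ^ 2) (Icc 0 1) :=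
    fun x hx => hz'.div ((hzc.sub continuousOn_const).pow 2)
      fun t ht => pow_ne_zero _ (hne x hx t ht)
  have hpb : p ∈ ball p (d / 2) := mem_ball_self (by linarith)
  have key := intervalIntegral.hasDerivAt_integral_of_dominated_loc_of_deriv_le
    (μ := volume) (a := (0 : ℝ)) (b := 1) (F := fun x t => z' t / (z t - x))
    (F' := fun x t => z' t / (z t - x) ^ 2) (x₀ := p) (s := ball p (d / 2))
    (bound := fun _ => M / (d / 2) ^ 2) (ball_mem_nhds p (by linarith)) ?_ ?_ ?_ ?_ ?_ ?_
  · have h2 := key.2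
    rwa [integral_inv_sub_sq_eq_zero hz hz' hcl hp] at h2
  · filter_upwards [ball_mem_nhds p (show 0 < d / 2 by linarith)] with x hx
    exact ((hcont x hx).mono hsub).aestronglyMeasurable measurableSet_uIoc
  · apply ContinuousOn.intervalIntegrable
    rw [uIcc_of_le zero_le_one]
    exact hcont p hpb
  · exact ((hcont2 p hpb).mono hsub).aestronglyMeasurable measurableSet_uIoc
  · refine Filter.Eventually.of_forall fun t ht x hx => ?_
    rw [norm_div, norm_pow]
    have h1 := hdist x hx t (hsub ht)
    exact div_le_div₀ ((norm_nonneg _).trans (hM t (hsub ht))) (hM t (hsub ht)) (by positivity)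
      (pow_le_pow_left₀ (by positivity) h1 2)
  · exact intervalIntegrable_const
  · refine Filter.Eventually.of_forall fun t ht x hx => ?_
    have h0 := hne x hx t (hsub ht)
    have h1 := (((hasDerivAt_id x).const_sub (z t)).inv h0).const_mul (z' t)
    simp only [id, Pi.inv_apply, neg_neg, mul_one_div] at h1
    exact h1

/-- The winding number vanishes on the unbounded components of the complement. -/
theorem integral_inv_sub_eq_zero_of_unbounded
    (hz : ∀ t ∈ Icc (0 : ℝ) 1, HasDerivWithinAt z (z' t) (Icc 0 1) t)
    (hz' : ContinuousOn z' (Icc 0 1)) (hcl : z 0 = z 1) {p : ℂ} (hp : p ∉ z '' Icc 0 1)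
    (hb : ¬ Bornology.IsBounded (connectedComponentIn (z '' Icc 0 1)ᶜ p)) :
    ∫ t in (0 : ℝ)..1, z' t / (z t - p) = 0 := by
  have hzc : ContinuousOn z (Icc 0 1) := fun t ht => (hz t ht).continuousWithinAt
  have hK : IsCompact (z '' Icc 0 1) := isCompact_Icc.image_of_continuousOn hzc
  set C := connectedComponentIn (z '' Icc 0 1)ᶜ p with hC
  have hCo : IsOpen C := hK.isClosed.isOpen_compl.connectedComponentIn
  have hder : ∀ q ∈ C, HasDerivAt (fun p => ∫ t in (0 : ℝ)..1, z' t / (z t - p)) 0 q :=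
    fun q hq => hasDerivAt_integral_inv_sub hz hz' hcl (connectedComponentIn_subset _ _ hq)
  have hconst : ∀ q ∈ C, ∫ t in (0 : ℝ)..1, z' t / (z t - p) =
      ∫ t in (0 : ℝ)..1, z' t / (z t - q) := fun q hq =>
    hCo.is_const_of_deriv_eq_zero isPreconnected_connectedComponentIn
      (fun q hq => (hder q hq).differentiableAt.differentiableWithinAt)
      (fun q hq => (hder q hq).deriv) (mem_connectedComponentIn hp) hq
  obtain ⟨M, hM⟩ := isCompact_Icc.exists_bound_of_continuousOn hz'
  obtain ⟨R, hR⟩ := isCompact_Icc.exists_bound_of_continuousOn hzc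
  have hM0 : 0 ≤ M := (norm_nonneg _).trans (hM 0 (by simp))
  rw [← norm_le_zero_iff]
  refine le_of_forall_pos_le_add fun ε hε => ?_
  -- The integral is constant on C, so it can be evaluated at a point so remote that the integrand
  -- is at most ε.
  have : ∃ q ∈ C, R + (M + 1) / ε < ‖q‖ := by
    by_contra hcon
    push Not at hcon
    exact hb (isBounded_iff_forall_norm_le.2 ⟨_, hcon⟩)
  obtain ⟨q, hq, hqR⟩ := this
  rw [hconst q hq, zero_add]
  have hpos : 0 < (M + 1) / ε := by positivity
  refine (intervalIntegral.norm_integral_le_of_norm_le_const (C := ε) fun t ht => ?_).trans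
    (by simp)
  rw [uIoc_of_le zero_le_one] at ht
  have ht' := Ioc_subset_Icc_self ht
  have h1 : (M + 1) / ε ≤ ‖z t - q‖ := by
    have := norm_sub_norm_le q (z t)
    rw [norm_sub_rev] at this
    linarith [hR t ht']
  rw [norm_div, div_le_iff₀ (hpos.trans_le h1)]
  have h2 : ε * ((M + 1) / ε) = M + 1 := mul_div_cancel₀ _ hε.ne'
  nlinarith [hM t ht', mul_le_mul_of_nonneg_left h1 hε.le]

/-- The curve is the image under p ↦ z(Re p) of a segment of the real axis, a null set of the plane,
and differentiable maps between spaces of equal dimension preserve null sets. -/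
theorem volume_image_Icc_eq_zero {a b : ℝ} (hz : DifferentiableOn ℝ z (Icc a b)) :
    volume (z '' Icc a b) = 0 := by
  let S : Set ℂ := {p | p.re ∈ Icc a b ∧ p.im = 0}
  have hS : volume S = 0 := by
    refine measure_mono_null ?_ (Measure.addHaar_submodule volume (LinearMap.ker Complex.imLm) ?_)
    · intro p hp
      exact LinearMap.mem_ker.2 hp.2
    · intro htop
      have : Complex.I ∈ LinearMap.ker Complex.imLm := htop ▸ Submodule.mem_top
      simp at this
  have hd : DifferentiableOn ℝ (fun p : ℂ => z p.re) S := by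
    refine DifferentiableOn.comp hz (Complex.reCLM.differentiable.differentiableOn) ?_
    exact fun p hp => hp.1
  refine measure_mono_null ?_
    (addHaar_image_eq_zero_of_differentiableOn_of_addHaar_eq_zero volume hd hS)
  rintro _ ⟨t, ht, rfl⟩
  exact ⟨t, ⟨by simpa using ht, by simp⟩, by simp⟩

/-- Green's formula for a rotation invariant area form on the region surrounded by a closed
curve of winding number one. -/
theorem integral_radial_div_eq_integral_boundedRegion
    (hz : ∀ t ∈ Icc (0 : ℝ) 1, HasDerivWithinAt z (z' t) (Icc 0 1) t)
    (hz' : ContinuousOn z' (Icc 0 1)) (hcl : z 0 = z 1)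
    (hw : ∀ p ∈ boundedRegion (z '' Icc 0 1),
      ∫ t in (0 : ℝ)..1, z' t / (z t - p) = 2 * Real.pi * Complex.I)
    {φ : ℝ → ℝ} (hφ : Continuous φ) :
    IntervalIntegrable (fun t => ((∫ s in (0 : ℝ)..‖z t‖, s * φ s : ℝ) : ℂ) * (z' t / z t))
      volume 0 1 ∧
    ∫ t in (0 : ℝ)..1, ((∫ s in (0 : ℝ)..‖z t‖, s * φ s : ℝ) : ℂ) * (z' t / z t) =
      Complex.I * ((∫ p in boundedRegion (z '' Icc 0 1), φ ‖p‖ : ℝ) : ℂ) := by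
  have hzc : ContinuousOn z (Icc 0 1) := fun t ht => (hz t ht).continuousWithinAt
  have hK : IsCompact (z '' Icc 0 1) := isCompact_Icc.image_of_continuousOn hzc
  obtain ⟨M, hM⟩ := isCompact_Icc.exists_bound_of_continuousOn hz'
  obtain ⟨R₀, hR₀⟩ := isCompact_Icc.exists_bound_of_continuousOn hzc
  set R := R₀ + 1 with hRdef
  have hzR : ∀ t ∈ Icc (0 : ℝ) 1, ‖z t‖ < R := fun t ht => by linarith [hR₀ t ht]
  have hR : 0 < R := (norm_nonneg _).trans_lt (hzR 0 (by simp))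
  have hsub : uIoc (0 : ℝ) 1 ⊆ Icc 0 1 := by
    rw [uIoc_of_le zero_le_one]
    exact Ioc_subset_Icc_self
  obtain ⟨N, hN⟩ := (isCompact_closedBall (0 : ℂ) R).exists_bound_of_continuousOn
    (f := fun p : ℂ => (φ ‖p‖ : ℂ)) (by fun_prop)
  have hM0 : 0 ≤ M := (norm_nonneg _).trans (hM 0 (by simp))
  have hN0 : 0 ≤ N := (norm_nonneg _).trans (hN 0 (by simp [hR.le]))
  have hmz : AEMeasurable z (volume.restrict (uIoc 0 1)) :=
    ((hzc.mono hsub).aestronglyMeasurable measurableSet_uIoc).aemeasurable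
  have hmz' : AEMeasurable z' (volume.restrict (uIoc 0 1)) :=
    ((hz'.mono hsub).aestronglyMeasurable measurableSet_uIoc).aemeasurable
  have hfin : IsFiniteMeasure (volume.restrict (uIoc (0 : ℝ) 1)) := by
    rw [uIoc_of_le zero_le_one]
    infer_instance
  have hmeas : AEStronglyMeasurable
      (Function.uncurry fun (t : ℝ) (p : ℂ) => z' t * ((φ ‖p‖ : ℂ) * (z t - p)⁻¹))
      ((volume.restrict (uIoc 0 1)).prod (volume.restrict (ball (0 : ℂ) R))) := by
    apply AEMeasurable.aestronglyMeasurable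
    have h1 : AEMeasurable (fun x : ℝ × ℂ => z x.1)
        ((volume.restrict (uIoc 0 1)).prod (volume.restrict (ball (0 : ℂ) R))) := hmz.comp_fst
    have h2 : AEMeasurable (fun x : ℝ × ℂ => z' x.1)
        ((volume.restrict (uIoc 0 1)).prod (volume.restrict (ball (0 : ℂ) R))) := hmz'.comp_fst
    have h3 : Measurable (fun x : ℝ × ℂ => (φ ‖x.2‖ : ℂ)) :=
      Continuous.measurable (by fun_prop)
    exact h2.mul (h3.aemeasurable.mul (h1.sub measurable_snd.aemeasurable).inv)
  have hint : Integrable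
      (Function.uncurry fun (t : ℝ) (p : ℂ) => z' t * ((φ ‖p‖ : ℂ) * (z t - p)⁻¹))
      ((volume.restrict (uIoc 0 1)).prod (volume.restrict (ball (0 : ℂ) R))) := by
    rw [integrable_prod_iff hmeas]
    constructor
    · refine (ae_restrict_iff' measurableSet_uIoc).2 (Filter.Eventually.of_forall fun t ht => ?_)
      exact ((integral_radial_mul_inv_sub hφ (hzR t (hsub ht))).1.const_mul (z' t))
    · refine Integrable.mono' (g := fun _ => M * (N * ∫ p in ball (0 : ℂ) (2 * R), ‖p‖⁻¹))
        (integrable_const _) hmeas.norm.integral_prod_right' ?_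
      refine (ae_restrict_iff' measurableSet_uIoc).2 (Filter.Eventually.of_forall fun t ht => ?_)
      rw [Real.norm_of_nonneg (integral_nonneg fun _ => norm_nonneg _)]
      obtain ⟨hi, hle⟩ := integrableOn_inv_norm_sub_ball (hzR t (hsub ht))
      calc ∫ p in ball (0 : ℂ) R, ‖z' t * ((φ ‖p‖ : ℂ) * (z t - p)⁻¹)‖
          ≤ ∫ p in ball (0 : ℂ) R, M * (N * ‖z t - p‖⁻¹) := by
            refine setIntegral_mono_on
              ((integral_radial_mul_inv_sub hφ (hzR t (hsub ht))).1.const_mul (z' t)).norm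
              ((hi.const_mul N).const_mul M) measurableSet_ball fun p hp => ?_
            rw [norm_mul, norm_mul, norm_inv]
            exact mul_le_mul (hM t (hsub ht)) (mul_le_mul_of_nonneg_right
              (hN p (ball_subset_closedBall hp)) (by positivity)) (by positivity) hM0
        _ = M * (N * ∫ p in ball (0 : ℂ) R, ‖z t - p‖⁻¹) := by
            rw [integral_const_mul, integral_const_mul]
        _ ≤ _ := by gcongr
  -- Integrating over p first yields 2π times the boundary integral, over t first 2πi times the area
  -- integral.
  have hswap := intervalIntegral_integral_swap hint
  have hpi : (2 * Real.pi : ℂ) ≠ 0 := by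
    simp [Real.pi_ne_zero]
  have hval : ∀ t ∈ uIoc (0 : ℝ) 1, ∫ p in ball (0 : ℂ) R, z' t * ((φ ‖p‖ : ℂ) * (z t - p)⁻¹) =
      2 * Real.pi * (((∫ s in (0 : ℝ)..‖z t‖, s * φ s : ℝ) : ℂ) * (z' t / z t)) := by
    intro t ht
    rw [integral_const_mul, (integral_radial_mul_inv_sub hφ (hzR t (hsub ht))).2]
    push_cast
    ring
  have hleft : ∫ t in (0 : ℝ)..1, ∫ p in ball (0 : ℂ) R, z' t * ((φ ‖p‖ : ℂ) * (z t - p)⁻¹)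
      = 2 * Real.pi * ∫ t in (0 : ℝ)..1,
        ((∫ s in (0 : ℝ)..‖z t‖, s * φ s : ℝ) : ℂ) * (z' t / z t) := by
    rw [← intervalIntegral.integral_const_mul]
    refine intervalIntegral.integral_congr_ae (Filter.Eventually.of_forall hval)
  have hKR : z '' Icc 0 1 ⊆ ball 0 R := by
    rintro _ ⟨t, ht, rfl⟩
    exact mem_ball_zero_iff.2 (hzR t ht)
  have hregR := boundedRegion_subset_ball hR hKR
  have hK0 : volume (z '' Icc (0 : ℝ) 1) = 0 := volume_image_Icc_eq_zero
    fun t ht => (hz t ht).differentiableWithinAt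
  have hright : ∫ p in ball (0 : ℂ) R, ∫ t in (0 : ℝ)..1, z' t * ((φ ‖p‖ : ℂ) * (z t - p)⁻¹)
      = 2 * Real.pi * (Complex.I * ((∫ p in boundedRegion (z '' Icc 0 1), φ ‖p‖ : ℝ) : ℂ)) := by
    have h1 : ∀ᵐ p : ℂ, p ∈ ball (0 : ℂ) R →
        ∫ t in (0 : ℝ)..1, z' t * ((φ ‖p‖ : ℂ) * (z t - p)⁻¹) =
          (boundedRegion (z '' Icc 0 1)).indicator
            (fun p : ℂ => (2 * Real.pi * Complex.I) * (φ ‖p‖ : ℂ)) p := by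
      -- Off the curve the winding integral is 2πi on the bounded components by `hw` and 0 on the
      -- unbounded ones; the curve itself is null.
      have : ∀ᵐ p : ℂ, p ∉ z '' Icc (0 : ℝ) 1 := measure_eq_zero_iff_ae_notMem.1 hK0
      filter_upwards [this] with p hp _
      have h2 : ∀ t, z' t * ((φ ‖p‖ : ℂ) * (z t - p)⁻¹) = (φ ‖p‖ : ℂ) * (z' t / (z t - p)) :=
        fun t => by ring
      simp_rw [h2]
      rw [intervalIntegral.integral_const_mul]
      by_cases hb : Bornology.IsBounded (connectedComponentIn (z '' Icc 0 1)ᶜ p)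
      · rw [hw p ⟨hp, hb⟩, indicator_of_mem (show p ∈ boundedRegion _ from ⟨hp, hb⟩), mul_comm]
      · rw [integral_inv_sub_eq_zero_of_unbounded hz hz' hcl hp hb, indicator_of_notMem
          (fun h => hb h.2), mul_zero]
    rw [setIntegral_congr_ae measurableSet_ball h1,
      setIntegral_indicator (isOpen_boundedRegion hK.isClosed).measurableSet,
      inter_eq_right.2 hregR, integral_const_mul, integral_complex_ofReal]
    ring
  rw [hleft, hright] at hswap
  refine ⟨?_, mul_left_cancel₀ hpi hswap⟩
  -- Integrability is also read off from Fubini, which avoids any discussion of z'/z near zeros of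
  -- z.
  rw [intervalIntegrable_iff]
  refine (((hint.integral_prod_left).congr ((ae_restrict_iff' measurableSet_uIoc).2
    (Filter.Eventually.of_forall hval))).const_mul (2 * Real.pi : ℂ)⁻¹).congr
    (Filter.Eventually.of_forall fun t => ?_)
  simp only
  rw [inv_mul_cancel_left₀ hpi]

end Winding

/-! ### Exponentials of Hermitian matrices on vectors. -/

section ExpSpectral

variable {ι : Type*} [Fintype ι]

open scoped Matrix.Norms.Operator in
theorem exp_mulVec_of_eigenvector [DecidableEq ι] {M : Matrix ι ι ℂ} {v : ι → ℂ} {ν : ℂ}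
    (h : M *ᵥ v = ν • v) : NormedSpace.exp M *ᵥ v = Complex.exp ν • v := by
  have h1 := NormedSpace.exp_series_hasSum_exp' (𝕂 := ℂ) M
  have hcont : Continuous (fun N : Matrix ι ι ℂ => N *ᵥ v) := by fun_prop
  have h2 := h1.map (⟨⟨fun N : Matrix ι ι ℂ => N *ᵥ v, zero_mulVec v⟩,
    fun A B => add_mulVec A B v⟩ : Matrix ι ι ℂ →+ (ι → ℂ)) hcont
  have hpow : ∀ k : ℕ, M ^ k *ᵥ v = ν ^ k • v := by
    intro k
    induction k with
    | zero => simp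
    | succ k ih =>
      rw [pow_succ, ← mulVec_mulVec, h, mulVec_smul, ih, smul_smul, pow_succ, mul_comm]
  have h3 := (NormedSpace.exp_series_hasSum_exp' (𝕂 := ℂ) ν).smul_const v
  rw [← Complex.exp_eq_exp_ℂ] at h3
  refine h2.unique ?_
  convert h3 using 1
  funext k
  simp [smul_mulVec, hpow, smul_smul]

open scoped ComplexOrder in
theorem mulVec_eq_zero_of_sq {M : Matrix ι ι ℂ} (hM : Mᴴ = M) {v : ι → ℂ}
    (h : M *ᵥ (M *ᵥ v) = 0) : M *ᵥ v = 0 := by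
  rw [← dotProduct_star_self_eq_zero, star_mulVec, hM, ← dotProduct_mulVec,
    h, dotProduct_zero]

/-- The exponential of a Hermitian matrix on a vector on which its square is a scalar. -/
theorem exp_mulVec_of_sq [DecidableEq ι] {M : Matrix ι ι ℂ} (hM : Mᴴ = M) {v : ι → ℂ} {μ : ℝ}
    (h : M *ᵥ (M *ᵥ v) = ((μ : ℂ) ^ 2) • v) :
    NormedSpace.exp M *ᵥ v =
      (Real.cosh μ : ℂ) • v + ((Real.sinh μ / μ : ℝ) : ℂ) • (M *ᵥ v) := by
  by_cases hμ : μ = 0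
  · subst hμ
    -- Here sinh 0 / 0 is 0 by convention, which is harmless because M v = 0.
    have h0 := mulVec_eq_zero_of_sq hM (by simpa using h)
    rw [exp_mulVec_of_eigenvector (ν := 0) (by simpa using h0), h0]
    simp
  · have hμ' : (μ : ℂ) ≠ 0 := by exact_mod_cast hμ
    -- The vectors μv ± Mv satisfy the eigenvector equation for ±μ, and v is their sum divided by
    -- 2μ.
    have hp : M *ᵥ ((μ : ℂ) • v + M *ᵥ v) = (μ : ℂ) • ((μ : ℂ) • v + M *ᵥ v) := by
      rw [mulVec_add, mulVec_smul, h, smul_add, smul_smul, sq, add_comm]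
    have hm : M *ᵥ ((μ : ℂ) • v - M *ᵥ v) = (-μ : ℂ) • ((μ : ℂ) • v - M *ᵥ v) := by
      rw [mulVec_sub, mulVec_smul, h, smul_sub, smul_smul, neg_smul, sq, neg_mul, neg_smul]
      abel
    have ep := exp_mulVec_of_eigenvector hp
    have em := exp_mulVec_of_eigenvector hm
    have hv : v = (2 * μ : ℂ)⁻¹ • (((μ : ℂ) • v + M *ᵥ v) + ((μ : ℂ) • v - M *ᵥ v)) := by
      rw [add_add_sub_cancel, ← two_smul ℂ, smul_smul, smul_smul]
      have : (2 * μ : ℂ)⁻¹ * 2 * μ = 1 := by field_simp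
      rw [this, one_smul]
    calc NormedSpace.exp M *ᵥ v
        = NormedSpace.exp M *ᵥ
          ((2 * μ : ℂ)⁻¹ • (((μ : ℂ) • v + M *ᵥ v) + ((μ : ℂ) • v - M *ᵥ v))) := by rw [← hv]
      _ = (2 * μ : ℂ)⁻¹ • (Complex.exp μ • ((μ : ℂ) • v + M *ᵥ v) +
            Complex.exp (-μ) • ((μ : ℂ) • v - M *ᵥ v)) := by
          rw [mulVec_smul, mulVec_add, ep, em]
      _ = _ := by
          push_cast
          rw [Complex.cosh, Complex.sinh]
          ext i
          simp only [Pi.smul_apply, Pi.add_apply, Pi.sub_apply, smul_eq_mul]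
          field_simp
          ring

end ExpSpectral

/-! ### Singular values of W and the exponential of (zW)^. -/

section Hat

variable {n m : ℕ}

theorem hat_conjTranspose (Y : Matrix (Fin m) (Fin n) ℂ) : (hat Y)ᴴ = hat Y := by
  simp [hat, fromBlocks_conjTranspose]

theorem hat_mulVec (Y : Matrix (Fin m) (Fin n) ℂ) (u : Fin n → ℂ) (w : Fin m → ℂ) :
    hat Y *ᵥ Sum.elim u w = Sum.elim (Yᴴ *ᵥ w) (Y *ᵥ u) := by
  simp [hat, fromBlocks_mulVec]

variable (X : Matrix (Fin m) (Fin n) ℂ)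

/-- The unitary matrix that diagonalises `X* X`. -/
noncomputable def gramUnitary : unitaryGroup (Fin n) ℂ :=
  (isHermitian_conjTranspose_mul_self X).eigenvectorUnitary

/-- The eigenvalues of `X* X`. -/
noncomputable def gramEigenvalues (j : Fin n) : ℝ :=
  (isHermitian_conjTranspose_mul_self X).eigenvalues j

/-- The singular values of `W = X / |X̂|`. -/
noncomputable def unitSingularValues (j : Fin n) : ℝ :=
  (Real.sqrt (metric (hat X) (hat X)))⁻¹ * Real.sqrt (gramEigenvalues X j)

open scoped ComplexOrder in
theorem gramEigenvalues_nonneg (j : Fin n) : 0 ≤ gramEigenvalues X j :=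
  (posSemidef_conjTranspose_mul_self X).eigenvalues_nonneg j

theorem gramUnitary_conjTranspose_mul :
    (gramUnitary X : Matrix (Fin n) (Fin n) ℂ)ᴴ * gramUnitary X = 1 :=
  Unitary.coe_star_mul_self (gramUnitary X)

theorem gramUnitary_mul_conjTranspose :
    (gramUnitary X : Matrix (Fin n) (Fin n) ℂ) * (gramUnitary X : Matrix (Fin n) (Fin n) ℂ)ᴴ = 1 :=
  Unitary.coe_mul_star_self (gramUnitary X)

theorem gram_mulVec (j : Fin n) :
    (Xᴴ * X) *ᵥ (gramUnitary X : Matrix (Fin n) (Fin n) ℂ).col j =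
      (gramEigenvalues X j : ℂ) • (gramUnitary X : Matrix (Fin n) (Fin n) ℂ).col j :=
  (isHermitian_conjTranspose_mul_self X).mulVec_eigenvectorBasis j

theorem gram_eq : Xᴴ * X = (gramUnitary X : Matrix (Fin n) (Fin n) ℂ) *
    diagonal (fun j => (gramEigenvalues X j : ℂ)) *
      (gramUnitary X : Matrix (Fin n) (Fin n) ℂ)ᴴ :=
  (isHermitian_conjTranspose_mul_self X).spectral_theorem

theorem metric_hat_self : metric (hat X) (hat X) = (trace (Xᴴ * X)).re := by
  have h2 : (trace (X * Xᴴ)) = trace (Xᴴ * X) := trace_mul_comm _ _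
  have h3 : trace ((hat X)ᴴ * hat X) = trace (Xᴴ * X) + trace (X * Xᴴ) := by
    simp [hat, fromBlocks_conjTranspose, fromBlocks_multiply, trace, Fintype.sum_sum_type]
  rw [metric, h3, h2, Complex.add_re]
  ring

open scoped ComplexOrder in
theorem metric_hat_self_pos (hX : X ≠ 0) : 0 < metric (hat X) (hat X) := by
  rw [metric_hat_self]
  have h1 := (posSemidef_conjTranspose_mul_self X).trace_nonneg
  have h2 : trace (Xᴴ * X) ≠ 0 := by
    rw [Ne, trace_conjTranspose_mul_self_eq_zero_iff]
    exact hX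
  have := lt_of_le_of_ne h1 h2.symm
  exact (Complex.pos_iff.1 this).1

theorem unitW_gram : (unitW X)ᴴ * unitW X =
    (((Real.sqrt (metric (hat X) (hat X)))⁻¹ ^ 2 : ℝ) : ℂ) • (Xᴴ * X) := by
  simp only [unitW, conjTranspose_smul, Matrix.smul_mul, Matrix.mul_smul, smul_smul]
  congr 1
  push_cast
  simp [sq]

-- The two off-diagonal blocks of Ŵ contribute equally to its norm, cancelling the factor 1/2 of the
-- metric, so this is |Ŵ|² = 1.
open scoped ComplexOrder in
theorem unitW_gram_trace (hX : X ≠ 0) : trace ((unitW X)ᴴ * unitW X) = 1 := by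
  have hp := metric_hat_self_pos X hX
  have h1 := (posSemidef_conjTranspose_mul_self X).trace_nonneg
  have h3 : trace (Xᴴ * X) = ((metric (hat X) (hat X) : ℝ) : ℂ) := by
    rw [metric_hat_self]
    apply Complex.ext
    · simp
    · simpa using (Complex.nonneg_iff.1 h1).2.symm
  rw [unitW_gram, trace_smul, h3, smul_eq_mul, ← Complex.ofReal_mul, inv_pow,
    Real.sq_sqrt hp.le, inv_mul_cancel₀ hp.ne', Complex.ofReal_one]

theorem unitW_gram_mulVec (j : Fin n) :
    ((unitW X)ᴴ * unitW X) *ᵥ (gramUnitary X : Matrix (Fin n) (Fin n) ℂ).col j =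
      ((unitSingularValues X j : ℂ) ^ 2) • (gramUnitary X : Matrix (Fin n) (Fin n) ℂ).col j := by
  rw [unitW_gram, smul_mulVec, gram_mulVec, smul_smul]
  congr 1
  rw [unitSingularValues, ← Complex.ofReal_mul, ← Complex.ofReal_pow, mul_pow,
    Real.sq_sqrt (gramEigenvalues_nonneg X j)]

/-- The square of Ŷ is diag(Y*Y, YY*), so an eigenvector of X*X padded by zeros is an eigenvector of
it, although not of Ŷ itself. -/
theorem hat_smul_unitW_sq_mulVec (z : ℂ) (j : Fin n) :
    hat (z • unitW X) *ᵥ (hat (z • unitW X) *ᵥ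
      Sum.elim ((gramUnitary X : Matrix (Fin n) (Fin n) ℂ).col j) 0) =
    (((‖z‖ * unitSingularValues X j : ℝ) : ℂ) ^ 2) •
      Sum.elim ((gramUnitary X : Matrix (Fin n) (Fin n) ℂ).col j) 0 := by
  rw [hat_mulVec, hat_mulVec]
  have h1 : (z • unitW X)ᴴ *ᵥ ((z • unitW X) *ᵥ (gramUnitary X : Matrix (Fin n) (Fin n) ℂ).col j) =
      (((‖z‖ * unitSingularValues X j : ℝ) : ℂ) ^ 2) •
        (gramUnitary X : Matrix (Fin n) (Fin n) ℂ).col j := by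
    rw [conjTranspose_smul, smul_mulVec, smul_mulVec, mulVec_smul, mulVec_mulVec,
      unitW_gram_mulVec, smul_smul, smul_smul]
    congr 1
    rw [Complex.star_def, Complex.conj_mul']
    push_cast
    ring
  rw [h1]
  simp only [mulVec_zero]
  ext i
  rcases i with i | i <;> simp

theorem toBlocks₁₁_mulVec (M : BMat n m) (u : Fin n → ℂ) (i : Fin n) :
    (M.toBlocks₁₁ *ᵥ u) i = (M *ᵥ Sum.elim u 0) (Sum.inl i) := by
  rw [← M.fromBlocks_toBlocks, fromBlocks_mulVec]
  simp

theorem hat_two_smul (Y : Matrix (Fin m) (Fin n) ℂ) : hat ((2 : ℂ) • Y) = hat Y + hat Y := by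
  rw [hat, hat, fromBlocks_add, two_smul, conjTranspose_add, add_zero, add_zero]

theorem eq_gramUnitary_conj_diagonal (M : Matrix (Fin n) (Fin n) ℂ) (d : Fin n → ℂ)
    (h : ∀ j, M *ᵥ (gramUnitary X : Matrix (Fin n) (Fin n) ℂ).col j =
      d j • (gramUnitary X : Matrix (Fin n) (Fin n) ℂ).col j) :
    M = (gramUnitary X : Matrix (Fin n) (Fin n) ℂ) * diagonal d *
      (gramUnitary X : Matrix (Fin n) (Fin n) ℂ)ᴴ := by
  have : M * (gramUnitary X : Matrix (Fin n) (Fin n) ℂ) =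
      (gramUnitary X : Matrix (Fin n) (Fin n) ℂ) * diagonal d := by
    ext i j
    have := congrFun (h j) i
    rw [mul_diagonal]
    simpa [mulVec, dotProduct, mul_apply, mul_comm] using this
  rw [← this, Matrix.mul_assoc, gramUnitary_mul_conjTranspose, Matrix.mul_one]

/-- The argument is doubled because the Maurer–Cartan pullback involves the square of exp((zW)^). -/
theorem exp_hat_two_mulVec (z : ℂ) (j : Fin n) :
    NormedSpace.exp (hat ((2 * z) • unitW X)) *ᵥ
      Sum.elim ((gramUnitary X : Matrix (Fin n) (Fin n) ℂ).col j) 0 =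
    (Real.cosh (2 * (‖z‖ * unitSingularValues X j)) : ℂ) •
      Sum.elim ((gramUnitary X : Matrix (Fin n) (Fin n) ℂ).col j) 0 +
    ((Real.sinh (2 * (‖z‖ * unitSingularValues X j)) /
        (2 * (‖z‖ * unitSingularValues X j)) : ℝ) : ℂ) •
      (hat ((2 * z) • unitW X) *ᵥ
        Sum.elim ((gramUnitary X : Matrix (Fin n) (Fin n) ℂ).col j) 0) := by
  have := hat_smul_unitW_sq_mulVec X (2 * z) j
  apply exp_mulVec_of_sq (hat_conjTranspose _)
  rw [this]
  congr 2
  simp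
  ring

/-- The upper left block of `exp(2 (zW)^)`. -/
theorem exp_hat_two_toBlocks₁₁ (z : ℂ) :
    (NormedSpace.exp (hat ((2 * z) • unitW X))).toBlocks₁₁ =
    (gramUnitary X : Matrix (Fin n) (Fin n) ℂ) *
      diagonal (fun j => (Real.cosh (2 * (‖z‖ * unitSingularValues X j)) : ℂ)) *
      (gramUnitary X : Matrix (Fin n) (Fin n) ℂ)ᴴ := by
  apply eq_gramUnitary_conj_diagonal
  intro j
  funext i
  -- The sinh term has its values in the lower component, so only cosh survives.
  rw [toBlocks₁₁_mulVec, exp_hat_two_mulVec, hat_mulVec]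
  simp

/-- The trace that gives the density of the area form. -/
theorem trace_conjTranspose_mul_exp_hat_two_toBlocks₂₁ (z : ℂ) :
    trace ((z • unitW X)ᴴ * (NormedSpace.exp (hat ((2 * z) • unitW X))).toBlocks₂₁) =
      ((∑ j, ‖z‖ * unitSingularValues X j *
        Real.sinh (2 * (‖z‖ * unitSingularValues X j)) : ℝ) : ℂ) := by
  -- As an upper left block this product is diagonal in the eigenbasis of X*X, and its trace is the
  -- sum of the eigenvalues.
  have hM : (z • unitW X)ᴴ * (NormedSpace.exp (hat ((2 * z) • unitW X))).toBlocks₂₁ =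
      (hat (z • unitW X) * NormedSpace.exp (hat ((2 * z) • unitW X))).toBlocks₁₁ := by
    conv_rhs => rw [← (NormedSpace.exp (hat ((2 * z) • unitW X))).fromBlocks_toBlocks, hat,
      fromBlocks_multiply, toBlocks_fromBlocks₁₁]
    simp
  rw [hM, eq_gramUnitary_conj_diagonal X (hat (z • unitW X) *
      NormedSpace.exp (hat ((2 * z) • unitW X))).toBlocks₁₁ (fun j => ((‖z‖ * unitSingularValues X j *
        Real.sinh (2 * (‖z‖ * unitSingularValues X j)) : ℝ) : ℂ)), trace_mul_comm,
    ← Matrix.mul_assoc, gramUnitary_conjTranspose_mul, Matrix.one_mul, trace_diagonal]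
  · push_cast
    rfl
  · intro j
    funext i
    rw [toBlocks₁₁_mulVec, ← mulVec_mulVec, exp_hat_two_mulVec, mul_smul, hat_two_smul,
      mulVec_add, mulVec_smul, mulVec_smul, add_mulVec, mulVec_add, hat_smul_unitW_sq_mulVec,
      hat_mulVec]
    simp only [Pi.add_apply, Pi.smul_apply, Sum.elim_inl, mulVec_zero, Pi.zero_apply,
      smul_eq_mul]
    by_cases hμ : ‖z‖ * unitSingularValues X j = 0
    · simp [hμ]
    · have : ((‖z‖ * unitSingularValues X j : ℝ) : ℂ) ≠ 0 := by exact_mod_cast hμ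
      generalize ‖z‖ * unitSingularValues X j = μ at *
      push_cast
      field_simp
      ring

end Hat

/-! ### The derivative of z ↦ exp((zW)^). -/

section ExpDerivative

variable {n m : ℕ} (W : Matrix (Fin m) (Fin n) ℂ)

/-- The infinitesimal rotation `diag(0, i)`. -/
def rotGen (n m : ℕ) : BMat n m := fromBlocks 0 0 0 (Complex.I • 1)

/-- The rotation `diag(1, c)`. -/
def rot (n m : ℕ) (c : ℂ) : BMat n m := fromBlocks 1 0 0 (c • 1)

theorem rot_mul_rot (c d : ℂ) : rot n m c * rot n m d = rot n m (c * d) := by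
  simp [rot, fromBlocks_multiply, smul_smul, mul_comm]

theorem rot_one : rot n m 1 = 1 := by simp [rot]

/-- The real linear map `z ↦ (zW)^`. -/
def hatLM : ℂ →ₗ[ℝ] BMat n m where
  toFun z := hat (z • W)
  map_add' a b := by
    simp [hat, add_smul, fromBlocks_add]
  map_smul' r a := by
    have h : ∀ (p q : ℕ) (M : Matrix (Fin p) (Fin q) ℂ), ((r : ℂ) • M) = r • M :=
      fun p q M => rfl
    simp [hat, fromBlocks_smul, mul_smul, h]

/-- The derivative of `z ↦ exp((zW)^)` at `z` in the direction `v`. -/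
noncomputable def expHatDeriv (z v : ℂ) : BMat n m :=
  if z = 0 then hat (v • W) else
    ((v / z).re : ℂ) • (NormedSpace.exp (hat (z • W)) * hat (z • W)) +
      ((v / z).im : ℂ) • (rotGen n m * NormedSpace.exp (hat (z • W)) -
        NormedSpace.exp (hat (z • W)) * rotGen n m)

open scoped Matrix.Norms.Operator

theorem contDiff_exp_hat :
    ContDiff ℝ (⊤ : ℕ∞) (fun z : ℂ => NormedSpace.exp (hat (z • W))) := by
  have h1 : ContDiff ℝ (⊤ : ℕ∞) (NormedSpace.exp : BMat n m → BMat n m) := by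
    rw [contDiff_iff_contDiffAt]
    intro x
    exact (NormedSpace.exp_analytic (𝕂 := ℝ) x).contDiffAt
  exact h1.comp (hatLM W).toContinuousLinearMap.contDiff

theorem hasDerivAt_rot : HasDerivAt (fun s : ℝ => rot n m (Complex.exp (s * Complex.I)))
    (rotGen n m) 0 := by
  have h1 : HasDerivAt (fun s : ℝ => Complex.exp (s * Complex.I)) Complex.I 0 := by
    have h := ((Complex.ofRealCLM.hasDerivAt (x := (0 : ℝ))).mul_const Complex.I).cexp
    simpa using h
  have h2 : ∀ c : ℂ, rot n m c = fromBlocks 1 0 0 0 + c • (fromBlocks 0 0 0 1 : BMat n m) := by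
    intro c
    simp [rot, fromBlocks_smul, fromBlocks_add]
  simp_rw [h2]
  have h3 := (h1.smul_const (fromBlocks 0 0 0 1 : BMat n m)).const_add (fromBlocks 1 0 0 0)
  exact h3.congr_deriv (by simp [rotGen, fromBlocks_smul])

theorem hat_rot_smul (c : ℂ) (Y : Matrix (Fin m) (Fin n) ℂ) :
    hat (c • Y) = rot n m c * hat Y * rot n m (starRingEnd ℂ c) := by
  simp [hat, rot, fromBlocks_multiply]

/-- Rotating z is conjugation by diag(1, c). This yields the derivative in the direction iz, in
which (zW)^ does not commute with its derivative. -/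
theorem exp_hat_rot_smul (c : ℂ) (hc : starRingEnd ℂ c * c = 1) (Y : Matrix (Fin m) (Fin n) ℂ) :
    NormedSpace.exp (hat (c • Y)) =
      rot n m c * NormedSpace.exp (hat Y) * rot n m (starRingEnd ℂ c) := by
  have hinv : (rot n m c)⁻¹ = rot n m (starRingEnd ℂ c) := by
    apply Matrix.inv_eq_left_inv
    rw [rot_mul_rot, hc, rot_one]
  have hu : IsUnit (rot n m c) := by
    refine ⟨⟨rot n m c, rot n m (starRingEnd ℂ c), ?_, ?_⟩, rfl⟩
    · rw [rot_mul_rot, mul_comm, hc, rot_one]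
    · rw [rot_mul_rot, hc, rot_one]
  rw [hat_rot_smul c, ← hinv, Matrix.exp_conj _ _ hu]

/-- The map is smooth, so its real derivative L is linear and is determined by the radial vector z
and the rotational vector iz. At z = 0 every direction is radial. -/
theorem hasDerivWithinAt_exp_hat {z : ℝ → ℂ} {v : ℂ} {s : Set ℝ} {t : ℝ}
    (hz : HasDerivWithinAt z v s t) :
    HasDerivWithinAt (fun t => NormedSpace.exp (hat (z t • W))) (expHatDeriv W (z t) v) s t := by
  obtain ⟨L, hL⟩ : ∃ L : ℂ →L[ℝ] BMat n m,
      HasFDerivAt (fun z : ℂ => NormedSpace.exp (hat (z • W))) L (z t) :=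
    ⟨_, ((contDiff_exp_hat W).differentiable (by simp)).differentiableAt.hasFDerivAt⟩
  have hmain := hL.comp_hasDerivWithinAt t hz
  suffices L v = expHatDeriv W (z t) v by rwa [← this]
  have hdir : ∀ (w : ℝ → ℂ) (w' : ℂ) (r : ℝ), HasDerivAt w w' r → w r = z t →
      HasDerivAt (fun r => NormedSpace.exp (hat (w r • W))) (L w') r := by
    intro w w' r hw hr
    rw [← hr] at hL
    exact hL.comp_hasDerivAt r hw
  have hline : ∀ u : ℂ, HasDerivAt (fun r : ℝ => (r : ℂ) * u) u 0 := fun u => by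
    simpa using (Complex.ofRealCLM.hasDerivAt (x := (0 : ℝ))).mul_const u
  have hreal : ∀ (r : ℝ) (u : ℂ), hat (((r : ℂ) * u) • W) = r • hat (u • W) := by
    intro r u
    have := (hatLM W).map_smul r u
    rwa [Complex.real_smul] at this
  unfold expHatDeriv
  split_ifs with h0
  · have h1 := hdir (fun r : ℝ => (r : ℂ) * v) v 0 (hline v) (by simp [h0])
    simp_rw [hreal] at h1
    have h2 := hasDerivAt_exp_smul_const (𝕂 := ℝ) (hat (v • W)) (0 : ℝ)
    rw [zero_smul, NormedSpace.exp_zero, one_mul] at h2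
    exact h1.unique h2
  · have hrad : L (z t) = NormedSpace.exp (hat (z t • W)) * hat (z t • W) := by
      have h1 := hdir (fun r : ℝ => (r : ℂ) * z t) (z t) 1
        (by simpa using (Complex.ofRealCLM.hasDerivAt (x := (1 : ℝ))).mul_const (z t)) (by simp)
      simp_rw [hreal] at h1
      have h2 := hasDerivAt_exp_smul_const (𝕂 := ℝ) (hat (z t • W)) (1 : ℝ)
      rw [one_smul] at h2
      exact h1.unique h2
    have hrot : L (Complex.I * z t) = rotGen n m * NormedSpace.exp (hat (z t • W)) -
        NormedSpace.exp (hat (z t • W)) * rotGen n m := by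
      have hc1 : HasDerivAt (fun s : ℝ => Complex.exp (s * Complex.I)) Complex.I 0 := by
        have h := ((Complex.ofRealCLM.hasDerivAt (x := (0 : ℝ))).mul_const Complex.I).cexp
        simpa using h
      have h1 := hdir (fun r : ℝ => Complex.exp (r * Complex.I) * z t) (Complex.I * z t) 0
        (hc1.mul_const _) (by simp)
      have hconj : ∀ r : ℝ, starRingEnd ℂ (Complex.exp (r * Complex.I)) =
          Complex.exp ((-r : ℝ) * Complex.I) := by
        intro r
        rw [← Complex.exp_conj]
        simp
      have hc : ∀ r : ℝ, starRingEnd ℂ (Complex.exp (r * Complex.I)) *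
          Complex.exp (r * Complex.I) = 1 := by
        intro r
        rw [hconj, ← Complex.exp_add]
        simp
      have hfun : (fun r : ℝ => NormedSpace.exp
          (hat ((Complex.exp (r * Complex.I) * z t) • W))) = fun r : ℝ =>
          rot n m (Complex.exp (r * Complex.I)) * NormedSpace.exp (hat (z t • W)) *
            rot n m (Complex.exp ((-r : ℝ) * Complex.I)) := by
        funext r
        rw [mul_smul, exp_hat_rot_smul _ (hc r), hconj]
      rw [hfun] at h1
      have hneg : HasDerivAt (fun r : ℝ => rot n m (Complex.exp ((-r : ℝ) * Complex.I)))
          (-rotGen n m) 0 := by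
        have h3 : HasDerivAt (fun s : ℝ => rot n m (Complex.exp (s * Complex.I)))
          (rotGen n m) (-0) := by simpa using hasDerivAt_rot
        have h4 := h3.scomp (0 : ℝ) (hasDerivAt_neg (0 : ℝ))
        rw [neg_one_smul] at h4
        exact h4
      have h2 := (hasDerivAt_rot.mul_const (NormedSpace.exp (hat (z t • W)))).mul hneg
      have := h1.unique h2
      rw [this]
      simp [rot_one, sub_eq_add_neg]
    have hv : v = (v / z t).re • z t + (v / z t).im • (Complex.I * z t) := by
      rw [Complex.real_smul, Complex.real_smul, ← mul_assoc, ← add_mul, Complex.re_add_im,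
        div_mul_cancel₀ _ h0]
    conv_lhs => rw [hv]
    rw [map_add, map_smul, map_smul, hrad, hrot]
    rfl

theorem hasDerivWithinAt_exp_hat_entry {z : ℝ → ℂ} {v : ℂ} {s : Set ℝ} {t : ℝ}
    (hz : HasDerivWithinAt z v s t) (i j : Fin n ⊕ Fin m) :
    HasDerivWithinAt (fun t => NormedSpace.exp (hat (z t • W)) i j)
      (expHatDeriv W (z t) v i j) s t := by
  have h := hasDerivWithinAt_exp_hat W hz
  exact ((entryLinearMap ℝ ℂ i j).toContinuousLinearMap.hasFDerivAt.comp_hasDerivWithinAt t h)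

theorem contDiffOn_exp_hat_entry {z : ℝ → ℂ} {s : Set ℝ} (hz : ContDiffOn ℝ (⊤ : ℕ∞) z s)
    (i j : Fin n ⊕ Fin m) :
    ContDiffOn ℝ (⊤ : ℕ∞) (fun t => NormedSpace.exp (hat (z t • W)) i j) s :=
  (entryLinearMap ℝ ℂ i j).toContinuousLinearMap.contDiff.comp_contDiffOn
    ((contDiff_exp_hat W).comp_contDiffOn hz)

end ExpDerivative

/-! ### Blocks of the Maurer–Cartan pullback. -/

section Pullback

variable {n m : ℕ} (W : Matrix (Fin m) (Fin n) ℂ)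

/-- The pullback of the Maurer–Cartan form under `z ↦ exp((zW)^)`. -/
noncomputable def pullbackMC (z v : ℂ) : BMat n m :=
  NormedSpace.exp (-hat (z • W)) * expHatDeriv W z v

/-- The case c = -1 of the rotation: conjugation by diag(1, -1) changes the sign of the off-diagonal
blocks. -/
theorem exp_neg_hat (Y : Matrix (Fin m) (Fin n) ℂ) :
    NormedSpace.exp (-hat Y) =
      fromBlocks (NormedSpace.exp (hat Y)).toBlocks₁₁ (-(NormedSpace.exp (hat Y)).toBlocks₁₂)
        (-(NormedSpace.exp (hat Y)).toBlocks₂₁) (NormedSpace.exp (hat Y)).toBlocks₂₂ := by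
  have h1 := exp_hat_rot_smul (-1) (by simp) Y
  have h2 : hat ((-1 : ℂ) • Y) = -hat Y := by simp [hat, fromBlocks_neg]
  rw [h2] at h1
  rw [h1]
  conv_lhs => rw [← (NormedSpace.exp (hat Y)).fromBlocks_toBlocks]
  simp [rot, fromBlocks_multiply]

theorem exp_neg_hat_mul (Y : Matrix (Fin m) (Fin n) ℂ) :
    NormedSpace.exp (-hat Y) * NormedSpace.exp (hat Y) = 1 := by
  rw [← Matrix.exp_add_of_commute _ _ ((Commute.refl (hat Y)).neg_left), neg_add_cancel,
        NormedSpace.exp_zero]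

theorem exp_hat_mul_exp_neg (Y : Matrix (Fin m) (Fin n) ℂ) :
    NormedSpace.exp (hat Y) * NormedSpace.exp (-hat Y) = 1 := by
  rw [← Matrix.exp_add_of_commute _ _ ((Commute.refl (hat Y)).neg_right), add_neg_cancel,
        NormedSpace.exp_zero]

theorem exp_hat_two (z : ℂ) :
    NormedSpace.exp (hat ((2 * z) • W)) =
      NormedSpace.exp (hat (z • W)) * NormedSpace.exp (hat (z • W)) := by
  rw [mul_smul, hat_two_smul, Matrix.exp_add_of_commute _ _ (Commute.refl _)]

/-- With Λ = diag(-1, 1) one has `rotGen` = (i/2)(1 + Λ) and E⁻¹ = ΛEΛ, hence E⁻¹·`rotGen`·E -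
`rotGen` = (i/2)Λ(E² - 1). -/
theorem exp_neg_hat_mul_rotGen_mul (z : ℂ) :
    NormedSpace.exp (-hat (z • W)) * rotGen n m * NormedSpace.exp (hat (z • W)) - rotGen n m =
      (Complex.I / 2) • fromBlocks
        (-((NormedSpace.exp (hat ((2 * z) • W))).toBlocks₁₁ - 1))
        (-(NormedSpace.exp (hat ((2 * z) • W))).toBlocks₁₂)
        (NormedSpace.exp (hat ((2 * z) • W))).toBlocks₂₁
        ((NormedSpace.exp (hat ((2 * z) • W))).toBlocks₂₂ - 1) := by
  have h1 := exp_hat_mul_exp_neg (z • W)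
  rw [exp_hat_two]
  rw [exp_neg_hat] at h1 ⊢
  generalize hE : NormedSpace.exp (hat (z • W)) = E at *
  rw [← E.fromBlocks_toBlocks] at h1 ⊢
  simp only [toBlocks_fromBlocks₁₁, toBlocks_fromBlocks₁₂, toBlocks_fromBlocks₂₁,
    toBlocks_fromBlocks₂₂, fromBlocks_multiply, rotGen] at h1 ⊢
  rw [← fromBlocks_one, fromBlocks_inj] at h1
  -- The blocks of E E⁻¹ = 1 are matrix forms of cosh² - sinh² = 1 and of the commutation of cosh
  -- with sinh.
  obtain ⟨e1, e2, e3, e4⟩ := h1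
  simp only [Matrix.mul_neg] at e1 e2 e3 e4
  rw [fromBlocks_smul, sub_eq_add_neg, fromBlocks_neg, fromBlocks_add]
  congr 1
  · rw [← e1]
    simp only [Matrix.mul_zero, Matrix.zero_mul, zero_add, add_zero, neg_zero, Matrix.neg_mul, Matrix.mul_smul,
      Matrix.mul_one, Matrix.smul_mul]
    module
  · have e2' : E.toBlocks₁₁ * E.toBlocks₁₂ = E.toBlocks₁₂ * E.toBlocks₂₂ := by
      rw [neg_add_eq_zero] at e2
      exact e2
    rw [e2']
    simp only [Matrix.mul_zero, Matrix.zero_mul, zero_add, add_zero, neg_zero, Matrix.neg_mul, Matrix.mul_smul,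
      Matrix.mul_one, Matrix.smul_mul]
    module
  · have e3' : E.toBlocks₂₁ * E.toBlocks₁₁ = E.toBlocks₂₂ * E.toBlocks₂₁ := by
      rwa [← sub_eq_add_neg, sub_eq_zero] at e3
    rw [e3']
    simp only [Matrix.mul_zero, Matrix.zero_mul, zero_add, add_zero, Matrix.mul_smul,
      Matrix.mul_one, Matrix.smul_mul]
    module
  · have e4' : (1 : Matrix (Fin m) (Fin m) ℂ) = E.toBlocks₂₂ * E.toBlocks₂₂ -
        E.toBlocks₂₁ * E.toBlocks₁₂ := by
      rw [← e4]
      abel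
    simp only [Matrix.mul_zero, Matrix.zero_mul, zero_add, add_zero, Matrix.mul_smul,
      Matrix.mul_one, Matrix.smul_mul]
    rw [e4']
    module

theorem pullbackMC_eq {z : ℂ} (hz : z ≠ 0) (v : ℂ) :
    pullbackMC W z v = ((v / z).re : ℂ) • hat (z • W) + (((v / z).im : ℂ) * (Complex.I / 2)) •
      fromBlocks
        (-((NormedSpace.exp (hat ((2 * z) • W))).toBlocks₁₁ - 1))
        (-(NormedSpace.exp (hat ((2 * z) • W))).toBlocks₁₂)
        (NormedSpace.exp (hat ((2 * z) • W))).toBlocks₂₁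
        ((NormedSpace.exp (hat ((2 * z) • W))).toBlocks₂₂ - 1) := by
  rw [pullbackMC, expHatDeriv, if_neg hz, mul_smul (((v / z).im : ℂ)),
    ← exp_neg_hat_mul_rotGen_mul, Matrix.mul_add, Matrix.mul_smul, Matrix.mul_smul,
    Matrix.mul_sub, ← Matrix.mul_assoc, ← Matrix.mul_assoc, ← Matrix.mul_assoc,
    exp_neg_hat_mul, Matrix.one_mul, Matrix.one_mul]

theorem pullbackMC_zero (v : ℂ) : pullbackMC W 0 v = hat (v • W) := by
  have : hat (0 : Matrix (Fin m) (Fin n) ℂ) = 0 := by simp [hat]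
  simp [pullbackMC, expHatDeriv, this]

/-- Only the rotational part of v contributes. The formula persists at z = 0, where v / 0 = 0 and
(vW)^ has no diagonal block. -/
theorem pullbackMC_toBlocks₁₁ (z v : ℂ) :
    (pullbackMC W z v).toBlocks₁₁ = (-Complex.I * (((v / z).im / 2 : ℝ) : ℂ)) •
      ((NormedSpace.exp (hat ((2 * z) • W))).toBlocks₁₁ - 1) := by
  by_cases hz : z = 0
  · subst hz
    rw [pullbackMC_zero]
    simp [hat]
  · rw [pullbackMC_eq W hz, hat, fromBlocks_smul, fromBlocks_smul, fromBlocks_add,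
      toBlocks_fromBlocks₁₁]
    push_cast
    module

theorem pullbackMC_toBlocks₂₁ {z : ℂ} (hz : z ≠ 0) (v : ℂ) :
    (pullbackMC W z v).toBlocks₂₁ = (((v / z).re : ℂ) * z) • W +
      (((v / z).im : ℂ) * (Complex.I / 2)) •
        (NormedSpace.exp (hat ((2 * z) • W))).toBlocks₂₁ := by
  rw [pullbackMC_eq W hz, hat, fromBlocks_smul, fromBlocks_smul, fromBlocks_add,
      toBlocks_fromBlocks₂₁, smul_smul]

theorem pullbackMC_toBlocks₁₂ {z : ℂ} (hz : z ≠ 0) (v : ℂ) :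
    (pullbackMC W z v).toBlocks₁₂ = ((pullbackMC W z v).toBlocks₂₁)ᴴ := by
  have hH : (NormedSpace.exp (hat ((2 * z) • W)))ᴴ = NormedSpace.exp (hat ((2 * z) • W)) := by
    rw [← Matrix.exp_conjTranspose, hat_conjTranspose]
  have h21 : ((NormedSpace.exp (hat ((2 * z) • W))).toBlocks₂₁)ᴴ =
      (NormedSpace.exp (hat ((2 * z) • W))).toBlocks₁₂ := by
    conv_rhs => rw [← hH]
    rfl
  rw [pullbackMC_toBlocks₂₁ W hz, conjTranspose_add, conjTranspose_smul, conjTranspose_smul, h21,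
    pullbackMC_eq W hz, hat, fromBlocks_smul, fromBlocks_smul, fromBlocks_add,
      toBlocks_fromBlocks₁₂]
  simp only [conjTranspose_smul, smul_smul, star_mul', star_div₀, Complex.star_def, Complex.conj_I,
    Complex.conj_ofReal, map_ofNat]
  module

end Pullback

/-! ### The radial density and its primitive. -/

section RadialDensity

/-- The density `s ↦ σ sinh(2σs) / s`, extended continuously to `s = 0`. -/
noncomputable def radialDensity (σ s : ℝ) : ℝ := 2 * σ ^ 2 * dslope Real.sinh 0 (2 * σ * s)

theorem continuous_radialDensity (σ : ℝ) : Continuous (radialDensity σ) := by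
  have h : Continuous (dslope Real.sinh 0) := by
    rw [← continuousOn_univ, continuousOn_dslope Filter.univ_mem]
    exact ⟨Real.continuous_sinh.continuousOn, Real.differentiable_sinh.differentiableAt⟩
  unfold radialDensity
  fun_prop

theorem mul_radialDensity (σ s : ℝ) : s * radialDensity σ s = σ * Real.sinh (2 * σ * s) := by
  have h := sub_smul_dslope Real.sinh 0 (2 * σ * s)
  simp only [sub_zero, smul_eq_mul, Real.sinh_zero] at h
  rw [radialDensity, ← h]
  ring

/-- The derivative of sinh²(σs) is σ sinh(2σs). This links the density of the area to the
coefficient sinh² of the phases. -/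
theorem integral_mul_radialDensity (σ r : ℝ) :
    ∫ s in (0 : ℝ)..r, s * radialDensity σ s = Real.sinh (σ * r) ^ 2 := by
  rw [intervalIntegral.integral_eq_sub_of_hasDerivAt (f := fun s => Real.sinh (σ * s) ^ 2)]
  · simp
  · intro s _
    have h1 : HasDerivAt (fun s => σ * s) σ s := by
      simpa using (hasDerivAt_id s).const_mul σ
    refine (h1.sinh.pow 2).congr_deriv ?_
    rw [mul_radialDensity, mul_assoc 2 σ s, Real.sinh_two_mul]
    push_cast
    ring
  · exact (continuous_id.mul (continuous_radialDensity σ)).intervalIntegrable _ _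

end RadialDensity

/-! ### The area form in the coordinate z. -/

section AreaDensity

variable {n m : ℕ}

theorem mat_mul (a b : U n m) : mat (a * b) = mat a * mat b := rfl

theorem mat_inv_mul (a : U n m) : mat a⁻¹ * mat a = 1 := by
  rw [← mat_mul, inv_mul_cancel]
  rfl

theorem mat_expHat_inv (Y : Matrix (Fin m) (Fin n) ℂ) :
    mat (expHat Y)⁻¹ = NormedSpace.exp (-hat Y) := rfl

theorem mat_surfUp (X : Matrix (Fin m) (Fin n) ℂ) (g : U n m) (z : ℂ) :
    mat (surfUp X g z) = mat g * NormedSpace.exp (hat (z • unitW X)) := rfl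

theorem mat_surfUp_inv (X : Matrix (Fin m) (Fin n) ℂ) (g : U n m) (z : ℂ) :
    mat (surfUp X g z)⁻¹ = NormedSpace.exp (-hat (z • unitW X)) * mat g⁻¹ := by
  rw [surfUp, _root_.mul_inv_rev, mat_mul, mat_expHat_inv]

theorem tangentUp_eq (X : Matrix (Fin m) (Fin n) ℂ) (g : U n m) (z v : ℂ) :
    tangentUp X g z v = mat g * expHatDeriv (unitW X) z v := by
  ext i j
  have hz : HasDerivWithinAt (fun s : ℝ => z + (s : ℂ) * v) v univ 0 := by
    have h := ((Complex.ofRealCLM.hasDerivAt (x := (0 : ℝ))).mul_const v).const_add z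
    simpa using h
  have h := fun k => (hasDerivWithinAt_exp_hat_entry (unitW X) hz k j).hasDerivAt
    Filter.univ_mem
  have hsum := HasDerivAt.fun_sum (u := Finset.univ) fun k _ => (h k).const_mul (mat g i k)
  simp only [Complex.ofReal_zero, zero_mul, add_zero] at hsum
  exact hsum.deriv

theorem surfUp_inv_mul_tangentUp (X : Matrix (Fin m) (Fin n) ℂ) (g : U n m) (z v : ℂ) :
    mat (surfUp X g z)⁻¹ * tangentUp X g z v = pullbackMC (unitW X) z v := by
  rw [tangentUp_eq, mat_surfUp_inv, Matrix.mul_assoc, ← Matrix.mul_assoc (mat g⁻¹), mat_inv_mul,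
    Matrix.one_mul, pullbackMC]

/-- The two off-diagonal blocks contribute complex conjugate traces, whose real parts add up and
cancel the factor 1/2. -/
theorem metric_hat_eq {M : BMat n m} (hM : M.toBlocks₁₂ = M.toBlocks₂₁ᴴ)
    (Y : Matrix (Fin m) (Fin n) ℂ) :
    metric M (hat Y) = (trace (Yᴴ * M.toBlocks₂₁)).re := by
  have h1 : trace (Mᴴ * hat Y) = trace (M.toBlocks₂₁ᴴ * Y) + trace (M.toBlocks₁₂ᴴ * Yᴴ) := by
    conv_lhs => rw [← M.fromBlocks_toBlocks]
    simp [hat, fromBlocks_conjTranspose, fromBlocks_multiply, trace, Fintype.sum_sum_type]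
  have h2 : trace (M.toBlocks₂₁ᴴ * Y) = star (trace (Yᴴ * M.toBlocks₂₁)) := by
    rw [← trace_conjTranspose, conjTranspose_mul, conjTranspose_conjTranspose]
  rw [metric, h1, hM, conjTranspose_conjTranspose, trace_mul_comm M.toBlocks₂₁, h2,
    Complex.add_re, Complex.star_def, Complex.conj_re]
  ring

/-- The pairings with Ŵ and (iW)^ are the real and imaginary parts of one complex number, Tr(W*
ω₂₁(v)). As a function of v it is division by z, then scaling of the imaginary part by T/2, then
multiplication by z, a real linear map of determinant T/2. -/
theorem areaForm_tangentUp (X : Matrix (Fin m) (Fin n) ℂ) (hX : X ≠ 0) (g : U n m) {z : ℂ}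
    (hz : z ≠ 0) :
    areaForm X (surfUp X g z) (tangentUp X g z 1) (tangentUp X g z Complex.I) =
      (1 / 2) * ∑ j, radialDensity (unitSingularValues X j) ‖z‖ := by
  set W := unitW X with hW
  have hT : ∑ j, ‖z‖ * unitSingularValues X j *
        Real.sinh (2 * (‖z‖ * unitSingularValues X j)) =
      ‖z‖ ^ 2 * ∑ j, radialDensity (unitSingularValues X j) ‖z‖ := by
    rw [Finset.mul_sum]
    refine Finset.sum_congr rfl fun j _ => ?_
    rw [sq, mul_assoc ‖z‖ ‖z‖, mul_radialDensity, ← mul_assoc, ← mul_assoc,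
      mul_right_comm 2 ‖z‖]
  set T := ∑ j, radialDensity (unitSingularValues X j) ‖z‖
  have hτ := trace_conjTranspose_mul_exp_hat_two_toBlocks₂₁ X z
  rw [hT, conjTranspose_smul, Matrix.smul_mul, trace_smul, smul_eq_mul, Complex.star_def,
    Complex.ofReal_mul, Complex.ofReal_pow, ← Complex.conj_mul', mul_assoc] at hτ
  have hτ' := mul_left_cancel₀ (by simpa using hz : starRingEnd ℂ z ≠ 0) hτ
  have hp : ∀ v, trace (Wᴴ * (pullbackMC W z v).toBlocks₂₁) =
      z * (((v / z).re : ℂ) + ((v / z).im : ℂ) * ((T / 2 : ℝ) : ℂ) * Complex.I) := by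
    intro v
    rw [pullbackMC_toBlocks₂₁ W hz, Matrix.mul_add, trace_add, Matrix.mul_smul, Matrix.mul_smul,
      trace_smul, trace_smul, hτ', unitW_gram_trace X hX]
    simp only [smul_eq_mul]
    push_cast
    ring
  have hm : ∀ v, metric (pullbackMC W z v) (hat W) =
      (z * (((v / z).re : ℂ) + ((v / z).im : ℂ) * ((T / 2 : ℝ) : ℂ) * Complex.I)).re := by
    intro v
    rw [metric_hat_eq (pullbackMC_toBlocks₁₂ W hz v), hp]
  have hm' : ∀ v, metric (pullbackMC W z v) (hat (Complex.I • W)) =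
      (z * (((v / z).re : ℂ) + ((v / z).im : ℂ) * ((T / 2 : ℝ) : ℂ) * Complex.I)).im := by
    intro v
    rw [metric_hat_eq (pullbackMC_toBlocks₁₂ W hz v), conjTranspose_smul, Matrix.smul_mul,
      trace_smul, hp]
    simp
  rw [areaForm, det_fin_two_of]
  simp only [surfUp_inv_mul_tangentUp, ← hW, hm, hm']
  have hI : Complex.I / z = Complex.I * (1 / z) := by ring
  have h1 : z.re * (1 / z).re - z.im * (1 / z).im = 1 := by
    have := congrArg Complex.re (mul_one_div_cancel hz)
    simpa using this
  have h2 : z.re * (1 / z).im + z.im * (1 / z).re = 0 := by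
    have := congrArg Complex.im (mul_one_div_cancel hz)
    simpa using this
  rw [hI]
  generalize 1 / z = q at *
  simp only [Complex.mul_re, Complex.mul_im, Complex.add_re, Complex.add_im, Complex.ofReal_re,
    Complex.ofReal_im, Complex.I_re, Complex.I_im]
  have h3 : (z.re ^ 2 + z.im ^ 2) * (q.re ^ 2 + q.im ^ 2) = 1 := by
    have : (z.re ^ 2 + z.im ^ 2) * (q.re ^ 2 + q.im ^ 2) =
      (z.re * q.re - z.im * q.im) ^ 2 + (z.re * q.im + z.im * q.re) ^ 2 := by ring
    rw [this, h1, h2]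
    norm_num
  calc _ = (z.re ^ 2 + z.im ^ 2) * (q.re ^ 2 + q.im ^ 2) * (1 / 2 * T) := by ring
    _ = _ := by rw [h3, one_mul]

end AreaDensity

/-! ### Phases and area as integrals over the surrounded region. -/

section AreaPhases

variable {n m : ℕ} {X : Matrix (Fin m) (Fin n) ℂ} {g : U n m} {c : ℝ → D n m}

/-- The `j`-th phase of the holonomy form along a curve with coordinate `z` and velocity `z'`. -/
noncomputable def phaseRate (X : Matrix (Fin m) (Fin n) ℂ) (j : Fin n) (z v : ℂ) : ℝ :=
  Real.sinh (unitSingularValues X j * ‖z‖) ^ 2 * (v / z).im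

theorem HolonomyU.IsSmoothSimpleClosedOn.hasDerivWithinAt (hc : IsSmoothSimpleClosedOn X g c) :
    ∀ t ∈ Icc (0 : ℝ) 1, HasDerivWithinAt (fun t => coord X g (c t))
      (derivWithin (fun s => coord X g (c s)) (Icc 0 1) t) (Icc 0 1) t := fun t ht =>
  ((hc.smooth.differentiableOn (by simp)) t ht).hasDerivWithinAt

theorem HolonomyU.IsSmoothSimpleClosedOn.continuousOn_derivWithin (hc : IsSmoothSimpleClosedOn X g c) :
    ContinuousOn (derivWithin (fun s => coord X g (c s)) (Icc 0 1)) (Icc (0 : ℝ) 1) :=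
  hc.smooth.continuousOn_derivWithin (uniqueDiffOn_Icc zero_lt_one) (by simp)

/-- The imaginary part of Green's formula with φ the j-th radial density; the orientation hypothesis
supplies winding number one. -/
theorem integral_phaseRate (hc : IsSmoothSimpleClosedOn X g c)
    (hor : IsOrientationPreserving X g c) (j : Fin n) :
    ∫ t in (0 : ℝ)..1, phaseRate X j (coord X g (c t))
      (derivWithin (fun s => coord X g (c s)) (Icc 0 1) t) =
    ∫ p in region X g c, radialDensity (unitSingularValues X j) ‖p‖ := by
  obtain ⟨hi, h⟩ := integral_radial_div_eq_integral_boundedRegion hc.hasDerivWithinAt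
    hc.continuousOn_derivWithin (congrArg (coord X g) hc.closed) (fun p hp => by
      have h := hor p hp
      rw [inv_mul_eq_iff_eq_mul₀ (by simp [Real.pi_ne_zero]), mul_one] at h
      exact h) (continuous_radialDensity (unitSingularValues X j))
  have h1 := intervalIntegral.intervalIntegral_im hi
  have h2 := congrArg Complex.im h
  rw [Complex.I_mul_im, Complex.ofReal_re] at h2
  refine Eq.trans ?_ h2
  refine Eq.trans ?_ h1
  refine intervalIntegral.integral_congr fun t _ => ?_
  simp only [integral_mul_radialDensity, phaseRate]
  rw [RCLike.im_eq_complex_im, Complex.im_ofReal_mul]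

theorem area_eq (hX : X ≠ 0) (hc : IsSmoothSimpleClosedOn X g c) :
    Area X g c = (1 / 2) * ∑ j, ∫ p in region X g c,
      radialDensity (unitSingularValues X j) ‖p‖ := by
  have hzc : ContinuousOn (fun t => coord X g (c t)) (Icc 0 1) := hc.smooth.continuousOn
  obtain ⟨R₀, hR₀⟩ := isCompact_Icc.exists_bound_of_continuousOn hzc
  have hKR : (fun t => coord X g (c t)) '' Icc 0 1 ⊆ ball 0 (R₀ + 1) := by
    rintro _ ⟨t, ht, rfl⟩
    exact mem_ball_zero_iff.2 (by linarith [hR₀ t ht])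
  have hR : 0 < R₀ + 1 := by linarith [(norm_nonneg _).trans (hR₀ 0 (by simp))]
  have hsub : region X g c ⊆ closedBall 0 (R₀ + 1) :=
    (boundedRegion_subset_ball hR hKR).trans ball_subset_closedBall
  have hint : ∀ j, IntegrableOn (fun p : ℂ => radialDensity (unitSingularValues X j) ‖p‖)
      (region X g c) := fun j =>
    (((continuous_radialDensity _).comp continuous_norm).continuousOn.integrableOn_compact
      (isCompact_closedBall _ _)).mono_set hsub
  rw [← integral_finsetSum _ fun j _ => hint j, ← integral_const_mul, Area]
  refine integral_congr_ae (ae_restrict_of_ae ?_)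
  -- The density was computed away from the origin, where division by z makes sense; one point is
  -- null.
  have : ∀ᵐ p : ℂ, p ≠ 0 := by simp [ae_iff, measure_singleton]
  filter_upwards [this] with p hp
  exact areaForm_tangentUp X hX g hp

end AreaPhases

/-! ### Entrywise calculus of matrix curves on [0,1], and smooth primitives. -/

section EntryCalculus

variable {ι κ ρ : Type*}

/-- The matrix valued curve `F` has the entrywise derivative `F'` at `t` within `s`. -/
def HasEntryDeriv (F : ℝ → Matrix ι κ ℂ) (F' : Matrix ι κ ℂ) (s : Set ℝ) (t : ℝ) : Prop :=
  ∀ i j, HasDerivWithinAt (fun r => F r i j) (F' i j) s t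

/-- The entries of the matrix valued curve `F` are smooth on `s`. -/
def EntrySmoothOn (F : ℝ → Matrix ι κ ℂ) (s : Set ℝ) : Prop :=
  ∀ i j, ContDiffOn ℝ (⊤ : ℕ∞) (fun r => F r i j) s

variable {F : ℝ → Matrix ι κ ℂ} {G : ℝ → Matrix κ ρ ℂ} {F' : Matrix ι κ ℂ} {G' : Matrix κ ρ ℂ}
  {s : Set ℝ} {t : ℝ}

theorem hasEntryDeriv_const (M : Matrix ι κ ℂ) : HasEntryDeriv (fun _ => M) 0 s t :=
  fun _ _ => hasDerivWithinAt_const _ _ _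

theorem HasEntryDeriv.mul [Fintype κ] (hF : HasEntryDeriv F F' s t) (hG : HasEntryDeriv G G' s t) :
    HasEntryDeriv (fun r => F r * G r) (F' * G t + F t * G') s t := by
  intro i j
  have h := HasDerivWithinAt.fun_sum (u := Finset.univ) fun k _ => (hF i k).mul (hG k j)
  simp only [Matrix.add_apply, mul_apply, ← Finset.sum_add_distrib]
  exact h

theorem HasEntryDeriv.conjTranspose (hF : HasEntryDeriv F F' s t) :
    HasEntryDeriv (fun r => (F r)ᴴ) F'ᴴ s t :=
  fun i j => (hF j i).star

theorem HasEntryDeriv.congr {F₁ : ℝ → Matrix ι κ ℂ} (hF : HasEntryDeriv F F' s t)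
    (h : ∀ r ∈ s, F₁ r = F r) (ht : t ∈ s) : HasEntryDeriv F₁ F' s t := fun i j =>
  (hF i j).congr (fun r hr => by rw [h r hr]) (by rw [h t ht])

theorem HasEntryDeriv.unique {F₁' : Matrix ι κ ℂ} (hs : UniqueDiffWithinAt ℝ s t)
    (hF : HasEntryDeriv F F' s t) (hF₁ : HasEntryDeriv F F₁' s t) : F' = F₁' := by
  ext i j
  exact hs.eq_deriv _ (hF i j) (hF₁ i j)

theorem EntrySmoothOn.hasEntryDeriv (hF : EntrySmoothOn F s) (ht : t ∈ s) :
    HasEntryDeriv F (Matrix.of fun i j => derivWithin (fun r => F r i j) s t) s t := fun i j =>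
  (((hF i j).differentiableOn (by simp)) t ht).hasDerivWithinAt

theorem entrySmoothOn_const (M : Matrix ι κ ℂ) : EntrySmoothOn (fun _ => M) s :=
  fun _ _ => contDiffOn_const

theorem EntrySmoothOn.mul [Fintype κ] (hF : EntrySmoothOn F s) (hG : EntrySmoothOn G s) :
    EntrySmoothOn (fun r => F r * G r) s := by
  intro i j
  simp only [mul_apply]
  exact ContDiffOn.sum fun k _ => (hF i k).mul (hG k j)

theorem hasEntryDeriv_fromBlocks {ι' κ' : Type*} {G : ℝ → Matrix ι' κ' ℂ} {G' : Matrix ι' κ' ℂ}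
    (hF : HasEntryDeriv F F' s t) (hG : HasEntryDeriv G G' s t) :
    HasEntryDeriv (fun r => fromBlocks (F r) 0 0 (G r)) (fromBlocks F' 0 0 G') s t := by
  rintro (i | i) (j | j)
  · exact hF i j
  · exact hasDerivWithinAt_const _ _ _
  · exact hasDerivWithinAt_const _ _ _
  · exact hG i j

theorem entrySmoothOn_fromBlocks {ι' κ' : Type*} {G : ℝ → Matrix ι' κ' ℂ}
    (hF : EntrySmoothOn F s) (hG : EntrySmoothOn G s) :
    EntrySmoothOn (fun r => fromBlocks (F r) 0 0 (G r)) s := by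
  rintro (i | i) (j | j)
  · exact hF i j
  · exact contDiffOn_const
  · exact contDiffOn_const
  · exact hG i j

theorem exists_smooth_primitive {α : ℝ → ℝ} (hα : ContDiffOn ℝ (⊤ : ℕ∞) α (Icc 0 1)) :
    ∃ θ : ℝ → ℝ, θ 0 = 0 ∧ θ 1 = ∫ t in (0 : ℝ)..1, α t ∧
      (∀ t ∈ Icc (0 : ℝ) 1, HasDerivWithinAt θ (α t) (Icc 0 1) t) ∧
      ContDiffOn ℝ (⊤ : ℕ∞) θ (Icc 0 1) := by
  -- Extending α by its end values makes it continuous on the whole line, so the fundamental theorem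
  -- also covers the endpoints.
  set β : ℝ → ℝ := IccExtend zero_le_one ((Icc (0 : ℝ) 1).domRestrict α) with hβ
  have hβc : Continuous β := hα.continuousOn.domRestrict.Icc_extend'
  have hβα : ∀ t ∈ Icc (0 : ℝ) 1, β t = α t := fun t ht => IccExtend_of_mem _ _ ht
  have hd : ∀ t ∈ Icc (0 : ℝ) 1,
      HasDerivWithinAt (fun t => ∫ s in (0 : ℝ)..t, β s) (α t) (Icc 0 1) t := fun t ht => by
    rw [← hβα t ht]
    exact (hβc.integral_hasStrictDerivAt 0 t).hasDerivAt.hasDerivWithinAt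
  refine ⟨fun t => ∫ s in (0 : ℝ)..t, β s, by simp, ?_, hd, ?_⟩
  · refine intervalIntegral.integral_congr fun t ht => ?_
    rw [uIcc_of_le zero_le_one] at ht
    exact hβα t ht
  · rw [contDiffOn_infty_iff_derivWithin (uniqueDiffOn_Icc zero_lt_one)]
    exact ⟨fun t ht => (hd t ht).differentiableWithinAt, hα.congr fun t ht =>
      (hd t ht).derivWithin (uniqueDiffOn_Icc zero_lt_one t ht)⟩

end EntryCalculus

/-! ### Functional calculus of X*X. -/

section Phases

variable {n m : ℕ} (X : Matrix (Fin m) (Fin n) ℂ)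

/-- The matrix with eigenvalues `d` in the eigenbasis of `X* X`. -/
noncomputable def gramConj (d : Fin n → ℂ) : Matrix (Fin n) (Fin n) ℂ :=
  (gramUnitary X : Matrix (Fin n) (Fin n) ℂ) * diagonal d *
    (gramUnitary X : Matrix (Fin n) (Fin n) ℂ)ᴴ

theorem gramConj_mul (d e : Fin n → ℂ) :
    gramConj X d * gramConj X e = gramConj X fun j => d j * e j := by
  unfold gramConj
  rw [← diagonal_mul_diagonal]
  simp only [Matrix.mul_assoc]
  rw [← Matrix.mul_assoc _ (gramUnitary X : Matrix (Fin n) (Fin n) ℂ),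
    gramUnitary_conjTranspose_mul, Matrix.one_mul]

theorem gramConj_one : gramConj X (fun _ => 1) = 1 := by
  rw [gramConj, diagonal_one, Matrix.mul_one, gramUnitary_mul_conjTranspose]

theorem gramConj_conjTranspose (d : Fin n → ℂ) :
    (gramConj X d)ᴴ = gramConj X fun j => star (d j) := by
  rw [gramConj, conjTranspose_mul, conjTranspose_mul, conjTranspose_conjTranspose,
    diagonal_conjTranspose, gramConj, Matrix.mul_assoc]
  rfl

theorem trace_gramConj (d : Fin n → ℂ) : trace (gramConj X d) = ∑ j, d j := by
  rw [gramConj, trace_mul_comm, ← Matrix.mul_assoc, gramUnitary_conjTranspose_mul, Matrix.one_mul,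
    trace_diagonal]

theorem gramConj_smul (a : ℂ) (d : Fin n → ℂ) :
    a • gramConj X d = gramConj X fun j => a * d j := by
  have : diagonal (fun j => a * d j) = a • diagonal d := by
    rw [← diagonal_smul]
    rfl
  rw [gramConj, gramConj, this, Matrix.mul_smul, Matrix.smul_mul]

theorem gramConj_neg (d : Fin n → ℂ) : -gramConj X d = gramConj X fun j => -d j := by
  have h := gramConj_smul X (-1) d
  simpa using h

theorem gramConj_sum {σ : Type*} (s : Finset σ) (d : σ → Fin n → ℂ) :
    ∑ k ∈ s, gramConj X (d k) = gramConj X fun j => ∑ k ∈ s, d k j := by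
  have : diagonal (fun j => ∑ k ∈ s, d k j) = ∑ k ∈ s, diagonal (d k) := by
    ext i j
    rw [Matrix.sum_apply]
    by_cases h : i = j
    · subst h
      simp
    · simp [h]
  simp only [gramConj]
  rw [this, Finset.mul_sum, Finset.sum_mul]

theorem gram_pow (k : ℕ) :
    (Xᴴ * X) ^ k = gramConj X fun j => (gramEigenvalues X j : ℂ) ^ k := by
  induction k with
  | zero => simp [gramConj_one]
  | succ k ih =>
    have h1 : Xᴴ * X = gramConj X fun j => (gramEigenvalues X j : ℂ) := gram_eq X
    rw [pow_succ, ih]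
    rw [h1, gramConj_mul]
    simp only [pow_succ]

theorem exp_gramConj (d : Fin n → ℂ) :
    NormedSpace.exp (gramConj X d) = gramConj X fun j => Complex.exp (d j) := by
  have hinv : (gramUnitary X : Matrix (Fin n) (Fin n) ℂ)⁻¹ =
      (gramUnitary X : Matrix (Fin n) (Fin n) ℂ)ᴴ :=
    Matrix.inv_eq_left_inv (gramUnitary_conjTranspose_mul X)
  have hu : IsUnit (gramUnitary X : Matrix (Fin n) (Fin n) ℂ) :=
    ⟨⟨_, _, gramUnitary_mul_conjTranspose X, gramUnitary_conjTranspose_mul X⟩, rfl⟩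
  rw [gramConj, ← hinv, Matrix.exp_conj _ _ hu, exp_diagonal, hinv, gramConj, Pi.exp_def]
  simp only [Complex.exp_eq_exp_ℂ]

/-- The unitary matrix with eigenvalues `e^{iτ_j}` in the eigenbasis of `X* X`. -/
noncomputable def phaseUnitary (τ : Fin n → ℝ) : unitaryGroup (Fin n) ℂ :=
  ⟨gramConj X fun j => Complex.exp (Complex.I * τ j), by
    have h : ∀ j, star (Complex.exp (Complex.I * τ j)) * Complex.exp (Complex.I * τ j) = 1 := by
      intro j
      rw [Complex.star_def, ← Complex.exp_conj, ← Complex.exp_add]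
      simp
    rw [mem_unitaryGroup_iff', star_eq_conjTranspose, gramConj_conjTranspose, gramConj_mul]
    simp only [h, gramConj_one]⟩

theorem coe_phaseUnitary (τ : Fin n → ℝ) :
    (phaseUnitary X τ : Matrix (Fin n) (Fin n) ℂ) =
      gramConj X fun j => Complex.exp (Complex.I * τ j) := rfl

theorem pullbackMC_unitW_toBlocks₁₁ (z v : ℂ) :
    (pullbackMC (unitW X) z v).toBlocks₁₁ =
      gramConj X fun j => -(Complex.I * phaseRate X j z v) := by
  have h : (NormedSpace.exp (hat ((2 * z) • unitW X))).toBlocks₁₁ - 1 =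
      gramConj X fun j => ((Real.cosh (2 * (‖z‖ * unitSingularValues X j)) - 1 : ℝ) : ℂ) := by
    rw [exp_hat_two_toBlocks₁₁, ← gramConj_one X, sub_eq_add_neg, gramConj_neg]
    unfold gramConj
    rw [← Matrix.add_mul, ← Matrix.mul_add, diagonal_add]
    push_cast
    rfl
  rw [pullbackMC_toBlocks₁₁, h, gramConj_smul]
  congr 1
  funext j
  rw [phaseRate, Real.cosh_two_mul, Real.cosh_sq, mul_comm (unitSingularValues X j)]
  push_cast
  ring

theorem gramConj_apply_diag (d : Fin n → ℂ) (j : Fin n) :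
    ((gramUnitary X : Matrix (Fin n) (Fin n) ℂ)ᴴ * gramConj X d * gramUnitary X) j j = d j := by
  have : (gramUnitary X : Matrix (Fin n) (Fin n) ℂ)ᴴ * gramConj X d * gramUnitary X =
      diagonal d := by
    rw [gramConj, Matrix.mul_assoc, Matrix.mul_assoc, gramUnitary_conjTranspose_mul, Matrix.mul_one,
      ← Matrix.mul_assoc, gramUnitary_conjTranspose_mul, Matrix.one_mul]
  rw [this, diagonal_apply_eq]

open Polynomial ComplexOrder in
/-- Functions of `X* X` that vanish on its kernel lie in the span of the first `rk X` powers. -/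
theorem gramConj_mem_holSpan {f : ℝ → ℝ} (hf : f 0 = 0) :
    (gramConj X fun j => Complex.I * (f (gramEigenvalues X j) : ℂ)) ∈ holSpan X := by
  classical
  set S : Finset ℝ := (Finset.univ.image (gramEigenvalues X)).erase 0 with hS
  -- The nodes are the distinct nonzero eigenvalues, and rk X counts the nonzero ones with
  -- multiplicity.
  have hcard : S.card ≤ X.rank := by
    have hr := (isHermitian_conjTranspose_mul_self X).rank_eq_card_non_zero_eigs
    rw [rank_conjTranspose_mul_self] at hr
    rw [hr, Fintype.card_subtype]
    have : S ⊆ (Finset.univ.filter fun j => gramEigenvalues X j ≠ 0).image (gramEigenvalues X) := by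
      intro x hx
      rw [hS, Finset.mem_erase, Finset.mem_image] at hx
      obtain ⟨hx0, j, _, rfl⟩ := hx
      exact Finset.mem_image_of_mem _ (Finset.mem_filter.2 ⟨Finset.mem_univ j, hx0⟩)
    exact (Finset.card_le_card this).trans Finset.card_image_le
  -- Interpolating f(x)/x and multiplying by x makes the exponents start at 1. The zero eigenvalue
  -- is then matched because f 0 = 0.
  set Q : ℝ[X] := Lagrange.interpolate S id fun x => f x / x with hQ
  have hdeg : Q.degree < S.card := Lagrange.degree_interpolate_lt _ (injOn_id _)
  have heval : ∀ j, f (gramEigenvalues X j) =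
      ∑ k ∈ Finset.range S.card, Q.coeff k * gramEigenvalues X j ^ (k + 1) := by
    intro j
    by_cases h0 : gramEigenvalues X j = 0
    · simp [h0, hf]
    · have hmem : gramEigenvalues X j ∈ S :=
        Finset.mem_erase.2 ⟨h0, Finset.mem_image_of_mem _ (Finset.mem_univ j)⟩
      have h1 := Lagrange.eval_interpolate_at_node (fun x => f x / x) (injOn_id (S : Set ℝ)) hmem
      rw [← hQ, id, eq_div_iff h0] at h1
      have h2 : Q.natDegree < S.card ∨ Q = 0 := by
        by_cases hQ0 : Q = 0
        · exact Or.inr hQ0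
        · exact Or.inl ((natDegree_lt_iff_degree_lt hQ0).2 hdeg)
      have h3 : Q.eval (gramEigenvalues X j) =
          ∑ k ∈ Finset.range S.card, Q.coeff k * gramEigenvalues X j ^ k := by
        rcases h2 with h2 | h2
        · exact eval_eq_sum_range' h2 _
        · simp [h2]
      rw [← h1, h3, Finset.sum_mul]
      refine Finset.sum_congr rfl fun k _ => ?_
      ring
  have hsum : (gramConj X fun j => Complex.I * (f (gramEigenvalues X j) : ℂ)) =
      ∑ k ∈ Finset.range S.card, Q.coeff k • (Complex.I • (Xᴴ * X) ^ (k + 1)) := by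
    have h1 : ∀ k, Q.coeff k • (Complex.I • (Xᴴ * X) ^ (k + 1)) =
        gramConj X fun j => Complex.I *
          ((Q.coeff k : ℂ) * (gramEigenvalues X j : ℂ) ^ (k + 1)) := by
      intro k
      have h2 : Q.coeff k • (Complex.I • (Xᴴ * X) ^ (k + 1)) =
        (Q.coeff k : ℂ) • (Complex.I • (Xᴴ * X) ^ (k + 1)) := rfl
      rw [h2, gram_pow, gramConj_smul, gramConj_smul]
      congr 1
      funext j
      ring
    simp_rw [h1]
    rw [gramConj_sum]
    congr 1
    funext j
    rw [heval j, ← Finset.mul_sum]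
    push_cast
    rfl
  rw [hsum]
  refine Submodule.sum_mem _ fun k hk => Submodule.smul_mem _ _ (Submodule.subset_span ?_)
  exact ⟨k + 1, ⟨by simp, (Nat.succ_le_of_lt (Finset.mem_range.1 hk)).trans hcard⟩, rfl⟩

end Phases

/-! ### Lifts in the moving frame and the horizontality equation. -/

section Lifts

variable {n m : ℕ}

theorem mat_blockDiag (p : unitaryGroup (Fin n) ℂ × unitaryGroup (Fin m) ℂ) :
    mat (blockDiag n m p) =
      fromBlocks (p.1 : Matrix (Fin n) (Fin n) ℂ) 0 0 (p.2 : Matrix (Fin m) (Fin m) ℂ) := rfl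

theorem blockDiag_injective : Function.Injective (blockDiag n m) := by
  intro p q h
  have h1 := congrArg mat h
  rw [mat_blockDiag, mat_blockDiag, fromBlocks_inj] at h1
  exact Prod.ext (Subtype.ext h1.1) (Subtype.ext h1.2.2.2)

theorem projE_mul_blockDiag_eq_iff (a : U n m) (p q : unitaryGroup (Fin n) ℂ × unitaryGroup (Fin m) ℂ) :
    projE (a * blockDiag n m p) = projE (a * blockDiag n m q) ↔ p.1 = q.1 := by
  rw [projE, projE, QuotientGroup.eq]
  have h1 : (a * blockDiag n m p)⁻¹ * (a * blockDiag n m q) = blockDiag n m (p⁻¹ * q) := by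
    rw [map_mul, map_inv]
    group
  rw [h1]
  constructor
  · rintro ⟨B, hB⟩
    have h2 := congrArg Prod.fst (blockDiag_injective hB)
    simp only [MonoidHom.inr_apply, Prod.fst_mul, Prod.fst_inv] at h2
    exact inv_mul_eq_one.1 h2.symm
  · intro h
    refine ⟨p.2⁻¹ * q.2, ?_⟩
    rw [MonoidHom.comp_apply]
    congr 1
    ext1
    · simp [h]
    · rfl

theorem act_projE (a : U n m) (h : unitaryGroup (Fin n) ℂ) :
    act (projE a) h = projE (a * blockDiag n m (h, 1)) := rfl

theorem bundleProj_projE (a : U n m) : bundleProj (projE a) = projD a := rfl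

theorem projD_mul_blockDiag (a : U n m) (p : unitaryGroup (Fin n) ℂ × unitaryGroup (Fin m) ℂ) :
    projD (a * blockDiag n m p) = projD a := by
  rw [projD, projD, QuotientGroup.eq]
  refine ⟨p⁻¹, ?_⟩
  rw [map_inv]
  group

theorem exists_eq_mul_blockDiag {a b : U n m} (h : projD a = projD b) :
    ∃ p : unitaryGroup (Fin n) ℂ × unitaryGroup (Fin m) ℂ, b = a * blockDiag n m p := by
  rw [projD, projD, QuotientGroup.eq] at h
  obtain ⟨p, hp⟩ := h
  exact ⟨p, by rw [hp]; group⟩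

theorem surf_coord {X : Matrix (Fin m) (Fin n) ℂ} {g : U n m} {p : D n m}
    (hp : p ∈ surface X g) : projD (surfUp X g (coord X g p)) = p :=
  Function.invFun_eq hp

theorem metric_blockDiag (M : BMat n m) (A : Matrix (Fin n) (Fin n) ℂ) :
    metric M (fromBlocks A 0 0 0) = (1 / 2) * (trace (M.toBlocks₁₁ᴴ * A)).re := by
  have h1 : trace (Mᴴ * fromBlocks A 0 0 0) = trace (M.toBlocks₁₁ᴴ * A) := by
    conv_lhs => rw [← M.fromBlocks_toBlocks]
    simp [fromBlocks_conjTranspose, fromBlocks_multiply, trace, Fintype.sum_sum_type]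
  rw [metric, h1]

theorem unitary_conjTranspose_mul {k : ℕ} (u : unitaryGroup (Fin k) ℂ) :
    (u : Matrix (Fin k) (Fin k) ℂ)ᴴ * u = 1 := Unitary.coe_star_mul_self u

theorem unitary_mul_conjTranspose {k : ℕ} (u : unitaryGroup (Fin k) ℂ) :
    (u : Matrix (Fin k) (Fin k) ℂ) * (u : Matrix (Fin k) (Fin k) ℂ)ᴴ = 1 :=
  Unitary.coe_mul_star_self u

variable (X : Matrix (Fin m) (Fin n) ℂ) (g : U n m) {z : ℝ → ℂ} {t : ℝ}

theorem hasEntryDeriv_exp_hat {v : ℂ} {s : Set ℝ} (hz : HasDerivWithinAt z v s t) :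
    HasEntryDeriv (fun t => NormedSpace.exp (hat (z t • unitW X))) (expHatDeriv (unitW X) (z t) v)
      s t := hasDerivWithinAt_exp_hat_entry _ hz

/-- The `𝔲(n)`-component of the velocity of a lift, in a moving frame over the surface. -/
theorem velocity_toBlocks₁₁ {v : ℂ} (ht : t ∈ Icc (0 : ℝ) 1)
    (hz : HasDerivWithinAt z v (Icc 0 1) t)
    {k : ℝ → unitaryGroup (Fin n) ℂ} {l : ℝ → unitaryGroup (Fin m) ℂ}
    {k' : Matrix (Fin n) (Fin n) ℂ} {l' : Matrix (Fin m) (Fin m) ℂ}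
    (hk : HasEntryDeriv (fun t => (k t : Matrix (Fin n) (Fin n) ℂ)) k' (Icc 0 1) t)
    (hl : HasEntryDeriv (fun t => (l t : Matrix (Fin m) (Fin m) ℂ)) l' (Icc 0 1) t)
    {γ : ℝ → U n m} (hγ : ∀ t ∈ Icc (0 : ℝ) 1,
      γ t = surfUp X g (z t) * blockDiag n m (k t, l t)) :
    (mat (γ t)⁻¹ * velocity γ t).toBlocks₁₁ = (k t : Matrix (Fin n) (Fin n) ℂ)ᴴ *
      ((pullbackMC (unitW X) (z t) v).toBlocks₁₁ * k t + k') := by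
  have h1 : HasEntryDeriv (fun t => mat (γ t))
      (mat g * (expHatDeriv (unitW X) (z t) v * fromBlocks (k t : Matrix _ _ ℂ) 0 0 (l t) +
        NormedSpace.exp (hat (z t • unitW X)) * fromBlocks k' 0 0 l')) (Icc 0 1) t := by
    have h2 := (hasEntryDeriv_const (mat g)).mul
      ((hasEntryDeriv_exp_hat X hz).mul (hasEntryDeriv_fromBlocks hk hl))
    rw [Matrix.zero_mul, zero_add] at h2
    refine h2.congr (fun r hr => ?_) ht
    rw [hγ r hr, mat_mul, mat_surfUp, mat_blockDiag, Matrix.mul_assoc]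
  have hvel : velocity γ t =
      mat g * (expHatDeriv (unitW X) (z t) v * fromBlocks (k t : Matrix _ _ ℂ) 0 0 (l t) +
        NormedSpace.exp (hat (z t • unitW X)) * fromBlocks k' 0 0 l') := by
    ext i j
    exact (h1 i j).derivWithin (uniqueDiffOn_Icc zero_lt_one t ht)
  have hinv : mat (γ t)⁻¹ =
      fromBlocks (k t : Matrix _ _ ℂ)ᴴ 0 0 (l t : Matrix _ _ ℂ)ᴴ *
        (NormedSpace.exp (-hat (z t • unitW X)) * mat g⁻¹) := by
    rw [hγ t ht, _root_.mul_inv_rev, mat_mul, mat_surfUp_inv]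
    rfl
  have hprod : mat (γ t)⁻¹ * velocity γ t =
      fromBlocks (k t : Matrix _ _ ℂ)ᴴ 0 0 (l t : Matrix _ _ ℂ)ᴴ *
        (pullbackMC (unitW X) (z t) v * fromBlocks (k t : Matrix _ _ ℂ) 0 0 (l t) +
          fromBlocks k' 0 0 l') := by
    rw [hvel, hinv, pullbackMC]
    simp only [Matrix.mul_assoc]
    rw [← Matrix.mul_assoc (mat g⁻¹), mat_inv_mul, Matrix.one_mul, Matrix.mul_add (NormedSpace.exp _),
      ← Matrix.mul_assoc _ (NormedSpace.exp _), exp_neg_hat_mul, Matrix.one_mul]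
  rw [hprod]
  conv_lhs => rw [← (pullbackMC (unitW X) (z t) v).fromBlocks_toBlocks]
  simp [fromBlocks_multiply, fromBlocks_add]

/-- A skew-Hermitian block that is orthogonal to `𝔲(n)` vanishes. -/
theorem toBlocks₁₁_eq_zero_of_orthogonal {M : BMat n m} (hskew : M.toBlocks₁₁ᴴ = -M.toBlocks₁₁)
    (h : ∀ A : Matrix (Fin n) (Fin n) ℂ, Aᴴ = -A → metric M (fromBlocks A 0 0 0) = 0) :
    M.toBlocks₁₁ = 0 := by
  have h1 := h _ hskew
  rw [metric_blockDiag] at h1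
  open scoped ComplexOrder in
  have h2 := (posSemidef_conjTranspose_mul_self M.toBlocks₁₁).trace_nonneg
  open scoped ComplexOrder in
  have h3 := (Complex.nonneg_iff.1 h2).2
  rw [← trace_conjTranspose_mul_self_eq_zero_iff]
  apply Complex.ext
  · simpa using h1
  · simpa using h3.symm

theorem pullbackMC_unitW_skew (z v : ℂ) :
    ((pullbackMC (unitW X) z v).toBlocks₁₁)ᴴ = -(pullbackMC (unitW X) z v).toBlocks₁₁ := by
  rw [pullbackMC_unitW_toBlocks₁₁, gramConj_conjTranspose, gramConj_neg]
  congr 1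
  funext j
  simp

/-- The moving frame component of a horizontal curve satisfies a linear equation. -/
theorem deriv_eq_of_horizontal {v : ℂ} (ht : t ∈ Icc (0 : ℝ) 1)
    (hz : HasDerivWithinAt z v (Icc 0 1) t)
    {k : ℝ → unitaryGroup (Fin n) ℂ} {l : ℝ → unitaryGroup (Fin m) ℂ}
    {k' : Matrix (Fin n) (Fin n) ℂ} {l' : Matrix (Fin m) (Fin m) ℂ}
    (hk : HasEntryDeriv (fun t => (k t : Matrix (Fin n) (Fin n) ℂ)) k' (Icc 0 1) t)
    (hl : HasEntryDeriv (fun t => (l t : Matrix (Fin m) (Fin m) ℂ)) l' (Icc 0 1) t)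
    {γ : ℝ → U n m} (hγ : ∀ t ∈ Icc (0 : ℝ) 1,
      γ t = surfUp X g (z t) * blockDiag n m (k t, l t))
    (hhor : ∀ A : Matrix (Fin n) (Fin n) ℂ, Aᴴ = -A →
      metric (mat (γ t)⁻¹ * velocity γ t) (fromBlocks A 0 0 0) = 0) :
    k' = (gramConj X fun j => Complex.I * phaseRate X j (z t) v) *
      (k t : Matrix (Fin n) (Fin n) ℂ) := by
  have hN := velocity_toBlocks₁₁ X g ht hz hk hl hγ
  -- Differentiating k*k = 1 shows that k*k' is skew-Hermitian. Hence the whole block lies in 𝔲(n),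
  -- and orthogonality to 𝔲(n) forces it to vanish.
  have hkk : (k t : Matrix (Fin n) (Fin n) ℂ)ᴴ * k' =
      -((k'ᴴ : Matrix (Fin n) (Fin n) ℂ) * (k t : Matrix (Fin n) (Fin n) ℂ)) := by
    have h1 := hk.conjTranspose.mul hk
    have h2 : HasEntryDeriv (fun t => (k t : Matrix (Fin n) (Fin n) ℂ)ᴴ *
        (k t : Matrix (Fin n) (Fin n) ℂ)) 0 (Icc 0 1) t :=
      (hasEntryDeriv_const 1).congr (fun r _ => unitary_conjTranspose_mul (k r)) ht
    have h3 := h1.unique (uniqueDiffOn_Icc zero_lt_one t ht) h2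
    rwa [add_comm, ← eq_neg_iff_add_eq_zero] at h3
  have hskew : (mat (γ t)⁻¹ * velocity γ t).toBlocks₁₁ᴴ =
      -(mat (γ t)⁻¹ * velocity γ t).toBlocks₁₁ := by
    rw [hN, Matrix.mul_add, conjTranspose_add, conjTranspose_mul, conjTranspose_mul,
      conjTranspose_mul, conjTranspose_conjTranspose, pullbackMC_unitW_skew, hkk, neg_add, neg_neg]
    congr 1
    · rw [Matrix.mul_neg, Matrix.neg_mul, Matrix.mul_assoc]
  have h0 := toBlocks₁₁_eq_zero_of_orthogonal hskew hhor
  rw [hN] at h0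
  have h1 := congrArg (fun M => (k t : Matrix (Fin n) (Fin n) ℂ) * M) h0
  simp only [Matrix.mul_zero] at h1
  rw [← Matrix.mul_assoc, unitary_mul_conjTranspose, Matrix.one_mul, add_comm,
    ← eq_neg_iff_add_eq_zero] at h1
  rw [h1, pullbackMC_unitW_toBlocks₁₁, ← Matrix.neg_mul, gramConj_neg]
  simp

/-- The solution of the linear equation of horizontal curves. -/
theorem eq_phaseUnitary_mul {k : ℝ → Matrix (Fin n) (Fin n) ℂ} {α θ : Fin n → ℝ → ℝ}
    (hθ : ∀ j, ∀ t ∈ Icc (0 : ℝ) 1, HasDerivWithinAt (θ j) (α j t) (Icc 0 1) t)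
    (hθ0 : ∀ j, θ j 0 = 0)
    (hk : ∀ t ∈ Icc (0 : ℝ) 1,
      HasEntryDeriv k ((gramConj X fun j => Complex.I * α j t) * k t) (Icc 0 1) t) :
    k 1 = (phaseUnitary X fun j => θ j 1) * k 0 := by
  obtain ⟨V, hV⟩ : ∃ V : Matrix (Fin n) (Fin n) ℂ, V = gramUnitary X := ⟨_, rfl⟩
  -- In the eigenbasis, which does not depend on t, the system decouples into scalar equations.
  have hq : ∀ t ∈ Icc (0 : ℝ) 1, HasEntryDeriv (fun t => Vᴴ * k t)
      (diagonal (fun j => Complex.I * (α j t : ℂ)) * (Vᴴ * k t)) (Icc 0 1) t := by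
    intro t ht
    have h1 := (hasEntryDeriv_const Vᴴ).mul (hk t ht)
    rw [Matrix.zero_mul, zero_add] at h1
    convert h1 using 1
    rw [gramConj, ← hV, ← Matrix.mul_assoc, ← Matrix.mul_assoc, ← Matrix.mul_assoc,
      ← Matrix.mul_assoc, hV, gramUnitary_conjTranspose_mul, Matrix.one_mul]
  have hent : ∀ j l, (Vᴴ * k 1) j l = Complex.exp (Complex.I * θ j 1) * (Vᴴ * k 0) j l := by
    intro j l
    -- The integrating factor e^{-iθ_j} turns each entry into a constant.
    have hd : ∀ t ∈ Icc (0 : ℝ) 1, HasDerivWithinAt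
        (fun t => Complex.exp (-(Complex.I * θ j t)) * (Vᴴ * k t) j l) 0 (Icc 0 1) t := by
      intro t ht
      have h1 := ((hθ j t ht).ofReal_comp.const_mul Complex.I).neg.cexp
      have h2 := h1.mul (hq t ht j l)
      refine h2.congr_deriv ?_
      rw [diagonal_mul]
      simp only [Pi.neg_apply]
      ring
    have hc := constant_of_derivWithin_zero (fun t ht => (hd t ht).differentiableWithinAt)
      (fun t ht => (hd t (Ico_subset_Icc_self ht)).derivWithin
        (uniqueDiffOn_Icc zero_lt_one t (Ico_subset_Icc_self ht))) 1 (by simp)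
    simp only [hθ0, Complex.ofReal_zero, mul_zero, neg_zero, Complex.exp_zero, one_mul] at hc
    rw [← hc, ← mul_assoc, ← Complex.exp_add, add_neg_cancel, Complex.exp_zero, one_mul]
  have hmat : Vᴴ * k 1 = diagonal (fun j => Complex.exp (Complex.I * θ j 1)) * (Vᴴ * k 0) := by
    ext j l
    rw [diagonal_mul, hent]
  rw [coe_phaseUnitary, gramConj, ← hV, Matrix.mul_assoc, Matrix.mul_assoc, ← hmat,
    ← Matrix.mul_assoc, hV, gramUnitary_mul_conjTranspose, Matrix.one_mul]

theorem entrySmoothOn_exp_hat (hz : ContDiffOn ℝ (⊤ : ℕ∞) z (Icc 0 1)) :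
    EntrySmoothOn (fun t => NormedSpace.exp (hat (z t • unitW X))) (Icc 0 1) :=
  contDiffOn_exp_hat_entry _ hz

theorem entrySmoothOn_exp_neg_hat (hz : ContDiffOn ℝ (⊤ : ℕ∞) z (Icc 0 1)) :
    EntrySmoothOn (fun t => NormedSpace.exp (-hat (z t • unitW X))) (Icc 0 1) := by
  have h := entrySmoothOn_exp_hat X hz.neg
  have h2 : ∀ Y : Matrix (Fin m) (Fin n) ℂ, hat (-Y) = -hat Y := by
    intro Y
    simp [hat, fromBlocks_neg]
  simpa only [neg_smul, h2] using h

/-- The quotient v/z hides the smoothness where the curve passes through z = 0. It is visible in the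
pullback ω₁₁, built from smooth exponentials and their derivatives, whose diagonal entries in the
eigenbasis are -i times the phase rates. -/
theorem contDiffOn_phaseRate (hz : ContDiffOn ℝ (⊤ : ℕ∞) z (Icc 0 1)) (j : Fin n) :
    ContDiffOn ℝ (⊤ : ℕ∞) (fun t => phaseRate X j (z t) (derivWithin z (Icc 0 1) t))
      (Icc 0 1) := by
  have hd : EntrySmoothOn (fun t => expHatDeriv (unitW X) (z t) (derivWithin z (Icc 0 1) t))
      (Icc 0 1) := by
    intro a b
    have h1 := (contDiffOn_infty_iff_derivWithin (uniqueDiffOn_Icc zero_lt_one)).1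
      (entrySmoothOn_exp_hat X hz a b)
    refine h1.2.congr fun t ht => ?_
    have h2 := ((hz.differentiableOn (by simp)) t ht).hasDerivWithinAt
    exact ((hasEntryDeriv_exp_hat X h2 a b).derivWithin (uniqueDiffOn_Icc zero_lt_one t ht)).symm
  have hM := (entrySmoothOn_exp_neg_hat X hz).mul hd
  have hM11 : EntrySmoothOn (fun t =>
      (pullbackMC (unitW X) (z t) (derivWithin z (Icc 0 1) t)).toBlocks₁₁) (Icc 0 1) :=
    fun a b => hM (Sum.inl a) (Sum.inl b)
  have hV := ((entrySmoothOn_const (gramUnitary X : Matrix (Fin n) (Fin n) ℂ)ᴴ).mul hM11).mul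
    (entrySmoothOn_const (gramUnitary X : Matrix (Fin n) (Fin n) ℂ)) j j
  have him := Complex.imCLM.contDiff.comp_contDiffOn hV.neg
  refine him.congr fun t _ => ?_
  simp only [Function.comp_apply, pullbackMC_unitW_toBlocks₁₁, gramConj_apply_diag]
  simp

theorem hasEntryDeriv_gramConj {d : Fin n → ℝ → ℂ} {d' : Fin n → ℂ} {s : Set ℝ}
    (h : ∀ j, HasDerivWithinAt (d j) (d' j) s t) :
    HasEntryDeriv (fun t => gramConj X fun j => d j t) (gramConj X d') s t := by
  have h1 : HasEntryDeriv (fun t => diagonal fun j => d j t) (diagonal d') s t := by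
    intro a b
    by_cases hab : a = b
    · subst hab
      simpa using h a
    · simpa [diagonal_apply_ne _ hab] using hasDerivWithinAt_const t s (0 : ℂ)
  have h2 := ((hasEntryDeriv_const (gramUnitary X : Matrix (Fin n) (Fin n) ℂ)).mul h1).mul
    (hasEntryDeriv_const (gramUnitary X : Matrix (Fin n) (Fin n) ℂ)ᴴ)
  simpa [gramConj] using h2

theorem entrySmoothOn_gramConj {d : Fin n → ℝ → ℂ} {s : Set ℝ}
    (h : ∀ j, ContDiffOn ℝ (⊤ : ℕ∞) (d j) s) :
    EntrySmoothOn (fun t => gramConj X fun j => d j t) s := by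
  have h1 : EntrySmoothOn (fun t => diagonal fun j => d j t) s := by
    intro a b
    by_cases hab : a = b
    · subst hab
      simpa using h a
    · simpa [diagonal_apply_ne _ hab] using contDiffOn_const
  exact ((entrySmoothOn_const _).mul h1).mul (entrySmoothOn_const _)

end Lifts

/-! ### Existence of horizontal lifts and their endpoints. -/

section Holonomy

variable {n m : ℕ} {X : Matrix (Fin m) (Fin n) ℂ} {g : U n m} {c : ℝ → D n m}

/-- Horizontal lifts of curves on the surface exist through every point of the fibre. -/
theorem exists_horizontalLift (hc : IsSmoothSimpleClosedOn X g c) {p : E n m}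
    (hp : bundleProj p = c 0) :
    ∃ chat : ℝ → E n m, IsHorizontalLift c chat ∧ chat 0 = p := by
  have hz := hc.hasDerivWithinAt
  choose θ hθ0 _ hθ hθs using fun j =>
    exists_smooth_primitive (contDiffOn_phaseRate X hc.smooth j)
  obtain ⟨γ₀, rfl⟩ : ∃ γ₀ : U n m, projE γ₀ = p := QuotientGroup.mk_surjective p
  rw [bundleProj_projE, ← surf_coord (hc.mem 0 (by simp))] at hp
  obtain ⟨⟨k₀, l₀⟩, rfl⟩ := exists_eq_mul_blockDiag hp.symm
  -- The explicit solution of the horizontality equation. The U(m)-component can stay constant,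
  -- since horizontality constrains only the 𝔲(n)-block.
  set k : ℝ → unitaryGroup (Fin n) ℂ := fun t => phaseUnitary X (fun j => θ j t) * k₀ with hk
  set γ : ℝ → U n m := fun t => surfUp X g (coord X g (c t)) * blockDiag n m (k t, l₀) with hγ
  have hphase : ∀ t ∈ Icc (0 : ℝ) 1, ∀ j, HasDerivWithinAt
      (fun t => Complex.exp (Complex.I * θ j t))
      (Complex.I * phaseRate X j (coord X g (c t))
        (derivWithin (fun s => coord X g (c s)) (Icc 0 1) t) * Complex.exp (Complex.I * θ j t))
      (Icc 0 1) t := by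
    intro t ht j
    exact ((hθ j t ht).ofReal_comp.const_mul Complex.I).cexp.congr_deriv (by ring)
  have hkd : ∀ t ∈ Icc (0 : ℝ) 1, HasEntryDeriv (fun t => (k t : Matrix (Fin n) (Fin n) ℂ))
      ((gramConj X fun j => Complex.I * phaseRate X j (coord X g (c t))
        (derivWithin (fun s => coord X g (c s)) (Icc 0 1) t)) *
          (k t : Matrix (Fin n) (Fin n) ℂ)) (Icc 0 1) t := by
    intro t ht
    have h1 := (hasEntryDeriv_gramConj X (hphase t ht)).mul
      (hasEntryDeriv_const (k₀ : Matrix (Fin n) (Fin n) ℂ))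
    rw [Matrix.mul_zero, add_zero, ← gramConj_mul, Matrix.mul_assoc] at h1
    exact h1
  have hks : EntrySmoothOn (fun t => (k t : Matrix (Fin n) (Fin n) ℂ)) (Icc 0 1) :=
    (entrySmoothOn_gramConj X fun j => Complex.contDiff_exp.comp_contDiffOn
      (contDiffOn_const.mul (Complex.ofRealCLM.contDiff.comp_contDiffOn (hθs j)))).mul
      (entrySmoothOn_const _)
  refine ⟨fun t => projE (γ t), ⟨fun t ht => ?_, γ, ?_, fun _ _ => rfl, fun t ht A _ => ?_⟩, ?_⟩
  · rw [bundleProj_projE, projD_mul_blockDiag, surf_coord (hc.mem t ht)]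
  · exact ((entrySmoothOn_const (mat g)).mul (entrySmoothOn_exp_hat X hc.smooth)).mul
      (entrySmoothOn_fromBlocks hks (entrySmoothOn_const (l₀ : Matrix (Fin m) (Fin m) ℂ)))
  · have h0 := velocity_toBlocks₁₁ X g ht (hz t ht) (hkd t ht)
      (l := fun _ => l₀) (hasEntryDeriv_const _) (γ := γ) (fun _ _ => rfl)
    rw [pullbackMC_unitW_toBlocks₁₁, ← gramConj_neg, Matrix.neg_mul, neg_add_cancel,
      Matrix.mul_zero] at h0
    rw [metric_blockDiag, h0]
    simp
  · have h1 : k 0 = k₀ := by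
      apply Subtype.ext
      simp only [hk, hθ0]
      rw [Submonoid.coe_mul, coe_phaseUnitary]
      simp [gramConj_one]
    simp only [hγ, h1]

/-- The endpoint of a horizontal lift of a curve on the surface. -/
theorem HolonomyU.IsHorizontalLift.endpoint_eq (hc : IsSmoothSimpleClosedOn X g c)
    {h : unitaryGroup (Fin n) ℂ} {chat : ℝ → E n m} (hl : IsHorizontalLift c chat)
    (h0 : chat 0 = act (basePoint X g (c 0)) h) {u : unitaryGroup (Fin n) ℂ}
    (hu : u = phaseUnitary X fun j => ∫ t in (0 : ℝ)..1, phaseRate X j (coord X g (c t))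
      (derivWithin (fun s => coord X g (c s)) (Icc 0 1) t)) :
    chat 1 = act (chat 0) (h⁻¹ * u * h) := by
  have hz := hc.hasDerivWithinAt
  choose θ hθ0 hθ1 hθ hθs using fun j =>
    exists_smooth_primitive (contDiffOn_phaseRate X hc.smooth j)
  obtain ⟨hproj, γ, hγs, hγ, hhor⟩ := hl
  have hdec : ∀ t : ℝ, ∃ p : unitaryGroup (Fin n) ℂ × unitaryGroup (Fin m) ℂ,
      t ∈ Icc (0 : ℝ) 1 → γ t = surfUp X g (coord X g (c t)) * blockDiag n m p := by
    intro t
    by_cases ht : t ∈ Icc (0 : ℝ) 1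
    · have h1 := hproj t ht
      rw [← hγ t ht, bundleProj_projE] at h1
      obtain ⟨p, hp⟩ := exists_eq_mul_blockDiag ((surf_coord (hc.mem t ht)).trans h1.symm)
      exact ⟨p, fun _ => hp⟩
    · exact ⟨1, fun h => absurd h ht⟩
  choose p hp using hdec
  -- The frame components `p t` were chosen pointwise. They are the diagonal blocks of this smooth
  -- curve, whence their differentiability.
  set F : ℝ → BMat n m := fun t =>
    NormedSpace.exp (-hat (coord X g (c t) • unitW X)) * mat g⁻¹ * mat (γ t) with hF
  have hFs : EntrySmoothOn F (Icc 0 1) :=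
    ((entrySmoothOn_exp_neg_hat X hc.smooth).mul (entrySmoothOn_const _)).mul hγs
  have hFp : ∀ t ∈ Icc (0 : ℝ) 1, F t =
      fromBlocks ((p t).1 : Matrix (Fin n) (Fin n) ℂ) 0 0 ((p t).2 : Matrix (Fin m) (Fin m) ℂ) := by
    intro t ht
    simp only [hF]
    rw [hp t ht, mat_mul, ← mat_surfUp_inv, ← Matrix.mul_assoc, mat_inv_mul, Matrix.one_mul,
      mat_blockDiag]
  have hk : ∀ t ∈ Icc (0 : ℝ) 1, HasEntryDeriv (fun t => ((p t).1 : Matrix (Fin n) (Fin n) ℂ))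
      ((gramConj X fun j => Complex.I * phaseRate X j (coord X g (c t))
        (derivWithin (fun s => coord X g (c s)) (Icc 0 1) t)) *
          ((p t).1 : Matrix (Fin n) (Fin n) ℂ)) (Icc 0 1) t := by
    intro t ht
    have hFd := hFs.hasEntryDeriv ht
    have h1 : HasEntryDeriv (fun t => ((p t).1 : Matrix (Fin n) (Fin n) ℂ)) _ (Icc 0 1) t :=
      HasEntryDeriv.congr (F := fun t => (F t).toBlocks₁₁)
        (fun i j => hFd (Sum.inl i) (Sum.inl j))
        (fun r hr => by rw [hFp r hr, toBlocks_fromBlocks₁₁]) ht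
    have h2 : HasEntryDeriv (fun t => ((p t).2 : Matrix (Fin m) (Fin m) ℂ)) _ (Icc 0 1) t :=
      HasEntryDeriv.congr (F := fun t => (F t).toBlocks₂₂)
        (fun i j => hFd (Sum.inr i) (Sum.inr j))
        (fun r hr => by rw [hFp r hr, toBlocks_fromBlocks₂₂]) ht
    rw [← deriv_eq_of_horizontal X g ht (hz t ht) h1 h2 hp (hhor t ht)]
    exact h1
  have hend := eq_phaseUnitary_mul X hθ hθ0 hk
  simp only [hθ1] at hend
  rw [← hu, ← Submonoid.coe_mul] at hend
  have hend : (p 1).1 = u * (p 0).1 := Subtype.ext hend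
  -- The starting point determines the U(n)-component, the only one that survives modulo U(m).
  have hstart : (p 0).1 = h := by
    rw [← hγ 0 (by simp), hp 0 (by simp), basePoint, act_projE, projE_mul_blockDiag_eq_iff] at h0
    exact h0
  -- As the curve closes up, both ends use the same frame, where the lift moves from h to uh =
  -- h·(h⁻¹uh).
  rw [h0, ← hγ 1 (by simp), hp 1 (by simp), ← hc.closed, basePoint, act_projE, act_projE,
    mul_assoc, ← map_mul, projE_mul_blockDiag_eq_iff, hend, hstart]
  simp [mul_assoc]

end Holonomy

end

/-! ### Assembly of the theorem. -/

theorem theorem1 (n m : ℕ) (X : Matrix (Fin m) (Fin n) ℂ) (hX : X ≠ 0) (g : U n m)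
    (c : ℝ → D n m) (hc : IsSmoothSimpleClosedOn X g c)
    (hor : IsOrientationPreserving X g c) :
    ∃ Ψ ∈ holSpan X, ∃ u : Matrix.unitaryGroup (Fin n) ℂ,
      (u : Matrix (Fin n) (Fin n) ℂ) = NormedSpace.exp Ψ ∧
      Matrix.trace Ψ = 2 * Complex.I * (Area X g c : ℂ) ∧
      -- horizontal lifts exist through every point of the fibre over `c 0`
      (∀ p : E n m, bundleProj p = c 0 →
        ∃ chat : ℝ → E n m, IsHorizontalLift c chat ∧ chat 0 = p) ∧
      -- lifts starting at the base point moved by an `h` that commutes with `X* X`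
      (∀ (h : Matrix.unitaryGroup (Fin n) ℂ) (chat : ℝ → E n m),
        Commute (h : Matrix (Fin n) (Fin n) ℂ) (X.conjTranspose * X) →
        IsHorizontalLift c chat → chat 0 = act (basePoint X g (c 0)) h →
        chat 1 = act (chat 0) u) ∧
      -- arbitrary lifts
      (∀ (h : Matrix.unitaryGroup (Fin n) ℂ) (chat : ℝ → E n m),
        IsHorizontalLift c chat → chat 0 = act (basePoint X g (c 0)) h →
        chat 1 = act (chat 0) (h⁻¹ * u * h)) := by
  set τ : Fin n → ℝ := fun j => ∫ t in (0 : ℝ)..1, phaseRate X j (coord X g (c t))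
      (derivWithin (fun s => coord X g (c s)) (Set.Icc 0 1) t) with hτ
  have hexp : (phaseUnitary X τ : Matrix (Fin n) (Fin n) ℂ) =
      NormedSpace.exp (gramConj X fun j => Complex.I * (τ j : ℂ)) := by
    rw [exp_gramConj, coe_phaseUnitary]
  -- The phase τ_j depends on j only through the eigenvalue x, via σ = √x / |X̂|, and vanishes at x
  -- = 0.
  have hmem : (gramConj X fun j => Complex.I * (τ j : ℂ)) ∈ holSpan X :=
    gramConj_mem_holSpan X (f := fun x => ∫ t in (0 : ℝ)..1,
      Real.sinh ((Real.sqrt (metric (hat X) (hat X)))⁻¹ * Real.sqrt x * ‖coord X g (c t)‖) ^ 2 *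
        (derivWithin (fun s => coord X g (c s)) (Set.Icc 0 1) t / coord X g (c t)).im) (by simp)
  refine ⟨_, hmem, phaseUnitary X τ, hexp, ?_, fun p hp => exists_horizontalLift hc hp,
    fun h chat hcomm hl h0 => ?_, fun h chat hl h0 => hl.endpoint_eq hc h0 rfl⟩
  · rw [trace_gramConj, area_eq hX hc, ← Finset.mul_sum, Finset.sum_congr rfl fun j _ =>
      congrArg Complex.ofReal (integral_phaseRate hc hor j)]
    push_cast
    ring
  · have hspan : ∀ Ψ ∈ holSpan X, Commute (h : Matrix (Fin n) (Fin n) ℂ) Ψ := by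
      intro Ψ hΨ
      induction hΨ using Submodule.span_induction with
      | mem x hx =>
        obtain ⟨k, _, rfl⟩ := hx
        exact (hcomm.pow_right k).smul_right _
      | zero => exact Commute.zero_right _
      | add x y _ _ hx hy => exact hx.add_right hy
      | smul a x _ hx => exact hx.smul_right a
    have hcu : phaseUnitary X τ * h = h * phaseUnitary X τ := by
      apply Subtype.ext
      rw [Submonoid.coe_mul, Submonoid.coe_mul, hexp]
      open scoped Matrix.Norms.Operator in
      exact ((hspan _ hmem).exp_right).symm.eq
    have hconj : h⁻¹ * phaseUnitary X τ * h = phaseUnitary X τ := by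
      rw [mul_assoc, hcu, inv_mul_cancel_left]
    rw [hl.endpoint_eq hc h0 rfl, ← hτ, hconj]
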